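/- Let $q_0,q_1,q_2$ be the vertices of an equilateral triangle in the plane, let $F_i$ be the homothety with ratio $1/2$ and fixed point $q_i$, and let $SG$ be the Sierpinski gasket, i.e. the unique nonempty compact set with $SG=\bigcup_{i=0}^2F_i(SG)$. Put $V_0=\{q_0,q_1,q_2\}$. For a word $w=(w_1,\dots,w_k)\in\{0,1,2\}^k$ write $F_w=F_{w_1}\circ\cdots\circ F_{w_k}$ and call $C_w=F_w(SG)$ a $k$-cell. Let $\mu$ be the self-similar probability measure on $SG$, which gives mass $3^{-k}$ to every $k$-cell. Let $V_m=\bigcup_{|w|=m}F_w(V_0)$, and for distinct $x,y$ write $x\sim_m y$ if $x,y\in F_w(V_0)$ for some $w$ of length $m$. A continuous function $h$ on $SG$ is harmonic if $h(x)=\frac14\sum_{y\sim_m x}h(y)$ for all $m$ and all $x\in V_m\setminus V_0$. Let $C_w$ be a $k$-cell with $C_w\cap V_0=\emptyset$, let $p_i=F_wq_i$, let $\rho$ be the height of the equilateral triangle with vertices $p_0,p_1,p_2$, and let $C_i$ be the $k$-cell with $C_i\cap C_w=\{p_i\}$ ($i=0,1,2$). For $0\le c_0,c_1,c_2\le 1$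 let $B(c_0,c_1,c_2)=C_w\cup E_0\cup E_1\cup E_2$, where $E_i$ is the part of $C_i$ cut off at its vertex $p_i$ by the line at distance $c_i\rho$ from $p_i$ that is perpendicular to the symmetry axis of $C_i$ through $p_i$. A set $B$ is called a $k$ level mean value neighborhood of a point $x$ if $B=B(c_0,c_1,c_2)$ for some such $k$-cell $C_w$ containing $x$ and some $c_0,c_1,c_2\in[0,1]$, and $$\frac1{\mu(B)}\int_B h\,d\mu=h(x)\qquad\text{for every harmonic function } h \text{ on } SG.$$ Theorem. Let $x\in SG\setminus V_0$, and let $k_0$ be the least $k$ for which some $k$-cell contains $x$ and does not meet $V_0$ (such a $k$ exists). Then there are sets $B_k(x)$, $k\ge k_0$, such that $B_k(x)$ is a $k$ level mean value neighborhood of $x$ for every $k\ge k_0$, the sets $B_k(x)$ form a base of neighborhoods of $x$ in $SG$, and $\bigcap_{k\ge k_0}B_k(x)=\{x\}$. -/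

import Mathlib

open MeasureTheory Topology

noncomputable section

namespace SierpinskiGasket

/-- The Euclidean plane. -/
abbrev Plane : Type := EuclideanSpace ℝ (Fin 2)

/-- The contraction `F_i`: the homothety with ratio `1/2` and fixed point `q i`. -/
def F (q : Fin 3 → Plane) (i : Fin 3) : Plane → Plane :=
  fun x => AffineMap.homothety (q i) (1 / 2 : ℝ) x

/-- `F_w = F_{w₁} ∘ ⋯ ∘ F_{w_m}` for a word `w = (w₁, …, w_m)`. -/
def Fw (q : Fin 3 → Plane) : List (Fin 3) → Plane → Plane
  | [] => id
  | i :: w => F q i ∘ Fw q w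

/-- The point with address `ω`, that is `lim_m F_{ω₀} ∘ ⋯ ∘ F_{ω_{m-1}} (y) = ∑ 2^{-(n+1)} q_{ω_n}`
(the limit does not depend on `y`). -/
def address (q : Fin 3 → Plane) (ω : ℕ → Fin 3) : Plane :=
  ∑' n : ℕ, ((1 / 2 : ℝ) ^ (n + 1)) • q (ω n)

/-- The Sierpinski gasket with corners `q 0, q 1, q 2`: the attractor of the iterated function
system `F_0, F_1, F_2`, as the set of all points that have an address. -/
def gasket (q : Fin 3 → Plane) : Set Plane := Set.range (address q)

/-- The self-similar probability measure: the law of the point whose address is a sequence of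
independent digits, each uniformly distributed on `{0, 1, 2}`. It gives mass `3^{-m}` to every
`m`-cell. -/
def gasketMeasure (q : Fin 3 → Plane) : Measure Plane :=
  (Measure.infinitePi fun _ : ℕ => (PMF.uniformOfFintype (Fin 3)).toMeasure).map (address q)

/-- The boundary `V_0`, the set of the three corners. -/
def boundary (q : Fin 3 → Plane) : Set Plane := Set.range q

/-- The cell `C_w = F_w(SG)`; its level is the length of `w`. -/
def cell (q : Fin 3 → Plane) (w : List (Fin 3)) : Set Plane := Fw q w '' gasket q

/-- The vertices `V_m` of the graph `Γ_m`. -/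
def vertices (q : Fin 3 → Plane) (m : ℕ) : Set Plane :=
  {x | ∃ w : List (Fin 3), w.length = m ∧ x ∈ Fw q w '' boundary q}

/-- The graph `Γ_m`: two different points are joined if they are corners of one `m`-cell. -/
def graph (q : Fin 3 → Plane) (m : ℕ) : SimpleGraph Plane where
  Adj x y := x ≠ y ∧
    ∃ w : List (Fin 3), w.length = m ∧ x ∈ Fw q w '' boundary q ∧ y ∈ Fw q w '' boundary q
  symm := ⟨fun _ _ ⟨hne, w, hw, hx, hy⟩ => ⟨hne.symm, w, hw, hy, hx⟩⟩
  loopless := ⟨fun _ h => h.1 rfl⟩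

/-- Harmonic functions on the gasket: continuous functions (only the values on the gasket matter)
whose value at each nonboundary vertex of `Γ_m` is a quarter of the sum over its neighbours in
`Γ_m`, for every `m`. -/
structure IsHarmonic (q : Fin 3 → Plane) (h : Plane → ℝ) : Prop where
  continuousOn : ContinuousOn h (gasket q)
  mean_value : ∀ m : ℕ, ∀ x ∈ vertices q m \ boundary q,
    h x = 1 / 4 * ∑ᶠ y ∈ (graph q m).neighborSet x, h y

/-- The size of `C_w`: the height of the equilateral triangle with corners `F_w q_0, F_w q_1,
F_w q_2`. -/
def cellSize (q : Fin 3 → Plane) (w : List (Fin 3)) : ℝ :=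
  dist (Fw q w (q 0)) (midpoint ℝ (Fw q w (q 1)) (Fw q w (q 2)))

/-- The part of the cell `C_v` cut off at its corner `p = F_v q_j` by the line at distance `d`
from `p` that is perpendicular to the symmetry axis of `C_v` through `p`. The axis runs from `p` to
the midpoint `m` of the opposite side, and `⟪y - p, m - p⟫ / ‖m - p‖` is the distance from `p`,
measured along the axis, at which `y` lies. -/
def cutOff (q : Fin 3 → Plane) (v : List (Fin 3)) (j : Fin 3) (d : ℝ) : Set Plane :=
  let p := Fw q v (q j)
  let m := midpoint ℝ (Fw q v (q (j + 1))) (Fw q v (q (j + 2)))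
  {y ∈ cell q v | inner ℝ (y - p) (m - p) / ‖m - p‖ ≤ d}

/-- `B` is a set `B(c_0, c_1, c_2) = C_w ∪ E_0 ∪ E_1 ∪ E_2` around the cell `C_w`. Here
`C_i = C_{v i}` is the cell of the same level as `C_w` that meets `C_w` exactly in `p_i = F_w q_i`,
`j i` tells which corner of `C_i` the point `p_i` is, and `E_i` is cut off from `C_i` at `p_i` by the
line at distance `c_i` times the size of `C_w`. -/
def IsCutOffUnion (q : Fin 3 → Plane) (w : List (Fin 3)) (B : Set Plane) : Prop :=
  ∃ (v : Fin 3 → List (Fin 3)) (j : Fin 3 → Fin 3) (c : Fin 3 → ℝ),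
    (∀ i, (v i).length = w.length ∧ cell q (v i) ∩ cell q w = {Fw q w (q i)} ∧
      Fw q (v i) (q (j i)) = Fw q w (q i) ∧ c i ∈ Set.Icc (0 : ℝ) 1) ∧
    B = cell q w ∪ ⋃ i, cutOff q (v i) (j i) (c i * cellSize q w)

/-- `B` is a `k` level mean value neighborhood of `x`: it belongs to the family
`B(c_0, c_1, c_2)` around some `k`-cell that contains `x` and does not meet `V_0`, and the average
over `B` of every harmonic function is its value at `x`. -/
def IsMeanValueNhd (q : Fin 3 → Plane) (k : ℕ) (x : Plane) (B : Set Plane) : Prop :=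
  (∃ w : List (Fin 3), w.length = k ∧ x ∈ cell q w ∧ Disjoint (cell q w) (boundary q) ∧
    IsCutOffUnion q w B) ∧
  ∀ h : Plane → ℝ, IsHarmonic q h → ⨍ y in B, h y ∂(gasketMeasure q) = h x

end SierpinskiGasket

end

open SierpinskiGasket

noncomputable section

namespace SierpinskiGasket

/-! Both sides of the mean value identity are combinations of the three values `h(p_i)`. On a cell a
harmonic function is determined by its corner values through the rule with weights 2/5, 2/5, 1/5, so
`h(x) = ∑ a_i h(p_i)` with `a` in the standard simplex (`obeysRule`, `ObeysRule.apply_address`,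
`exists_coefficients`). On a cut piece `E_i` the reflection symmetry gives the two far corners of
`C_i` the same weight; the mean value equation at `p_i` then replaces their sum by `4h(p_i)` minus
the values at the two other corners of `C_w`. Write `m(c)` for the mass of a cut and `b(c)` for the
weight of a far corner, both relative to the cell. The average over `B(c)` has coefficients `(1/3 +
m(c_i) + 3b(c_i) - ∑ b(c_l)) / (1 + ∑ m(c_l))` (`setIntegral_cutOffUnion`,
`setAverage_cutOffUnion`).

It remains to reach every `a` of the simplex (`exists_heights`). At an index where `a` is minimal
the height is 0, and subtracting that equation leaves `m(c_i) + 3b(c_i) = M(a_i - min a)` with `M =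
1 + ∑ m(c_l)`. For given `M` this is solved by monotonicity and continuity, and an intermediate
value argument in `M ∈ [1, 3]` makes `M` consistent. Continuity of `m` and `b` holds because cutting
lines are null sets (`measure_bary_eq`).

Two `k`-cells share at most one point, a corner of both, and no point lies in three of them
(`exists_corner_of_Fw_eq`, `eq_or_eq_of_mem_cells`). Hence `C_w` is already a neighborhood of `x`
unless `x = p_i`, and then `c_i > 0` is forced. The diameters are of order `2^{-k}`, which gives the
base and the intersection.

Integrals are computed on the space of digit sequences. There `lam` is a function of the address, so
points with two addresses need no care. -/

/-- `q` is the list of corners of an equilateral triangle with side length `s`. -/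
structure IsEquilateral (q : Fin 3 → Plane) (s : ℝ) : Prop where
  pos : 0 < s
  dist_eq : ∀ i j, i ≠ j → dist (q i) (q j) = s

/-! ### Addresses -/

/-- The sequence that starts with `i` and goes on with `ω`. -/
def consSeq (i : Fin 3) (ω : ℕ → Fin 3) : ℕ → Fin 3
  | 0 => i
  | n + 1 => ω n

/-- The barycentric coordinate with index `j` of the point with address `ω`. -/
def bary (j : Fin 3) (ω : ℕ → Fin 3) : ℝ :=
  ∑' n : ℕ, (1 / 2 : ℝ) ^ (n + 1) * (if ω n = j then 1 else 0)

lemma hasSum_half_pow : HasSum (fun n : ℕ => (1 / 2 : ℝ) ^ (n + 1)) 1 := by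
  have h := (hasSum_geometric_of_lt_one (r := (1 / 2 : ℝ)) (by norm_num) (by norm_num)).mul_left
    (1 / 2 : ℝ)
  norm_num at h
  simpa only [pow_succ'] using h

lemma bary_term_le (j : Fin 3) (ω : ℕ → Fin 3) (n : ℕ) :
    (1 / 2 : ℝ) ^ (n + 1) * (if ω n = j then 1 else 0) ≤ (1 / 2 : ℝ) ^ (n + 1) := by
  split_ifs <;> simp

lemma bary_term_nonneg (j : Fin 3) (ω : ℕ → Fin 3) (n : ℕ) :
    0 ≤ (1 / 2 : ℝ) ^ (n + 1) * (if ω n = j then 1 else 0) := by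
  split_ifs <;> simp

lemma summable_bary (j : Fin 3) (ω : ℕ → Fin 3) :
    Summable fun n : ℕ => (1 / 2 : ℝ) ^ (n + 1) * (if ω n = j then 1 else 0) :=
  Summable.of_nonneg_of_le (bary_term_nonneg j ω) (bary_term_le j ω) hasSum_half_pow.summable

lemma bary_nonneg (j : Fin 3) (ω : ℕ → Fin 3) : 0 ≤ bary j ω :=
  tsum_nonneg (bary_term_nonneg j ω)

lemma bary_le_one (j : Fin 3) (ω : ℕ → Fin 3) : bary j ω ≤ 1 :=
  hasSum_le (bary_term_le j ω) (summable_bary j ω).hasSum hasSum_half_pow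

lemma sum_bary (ω : ℕ → Fin 3) : ∑ j, bary j ω = 1 := by
  unfold bary
  rw [← Summable.tsum_finsetSum fun j _ => summable_bary j ω]
  refine (tsum_congr fun n => ?_).trans hasSum_half_pow.tsum_eq
  rw [← Finset.mul_sum]
  simp

lemma bary_consSeq (i j : Fin 3) (ω : ℕ → Fin 3) :
    bary j (consSeq i ω) = (bary j ω + if i = j then 1 else 0) / 2 := by
  unfold bary
  rw [(summable_bary j (consSeq i ω)).tsum_eq_zero_add]
  have : ∀ n, (1 / 2 : ℝ) ^ (n + 1 + 1) * (if consSeq i ω (n + 1) = j then 1 else 0)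
      = 1 / 2 * ((1 / 2 : ℝ) ^ (n + 1) * (if ω n = j then 1 else 0)) := by
    intro n
    rw [show consSeq i ω (n + 1) = ω n from rfl, pow_succ]
    ring
  rw [tsum_congr this, tsum_mul_left, show consSeq i ω 0 = i from rfl]
  ring

/-- The symmetry group of the triangle acts on addresses by permuting digits; this reduces all cuts
to the corner with index 0. -/
lemma bary_comp_perm (σ : Equiv.Perm (Fin 3)) (j : Fin 3) (ω : ℕ → Fin 3) :
    bary (σ j) (σ ∘ ω) = bary j ω := by
  simp [bary]

lemma continuous_bary (j : Fin 3) : Continuous (bary j) := by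
  refine continuous_tsum (fun n => ?_) hasSum_half_pow.summable fun n ω => ?_
  · have h : Continuous fun i : Fin 3 => (1 / 2 : ℝ) ^ (n + 1) * (if i = j then (1 : ℝ) else 0) :=
      continuous_of_discreteTopology
    exact h.comp (continuous_apply n)
  · rw [Real.norm_of_nonneg (bary_term_nonneg j ω n)]
    exact bary_term_le j ω n

variable {q : Fin 3 → Plane} {s : ℝ}

lemma address_eq_sum (q : Fin 3 → Plane) (ω : ℕ → Fin 3) :
    address q ω = ∑ j, bary j ω • q j := by
  unfold address bary
  simp_rw [← fun j => (summable_bary j ω).tsum_smul_const (q j)]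
  rw [← Summable.tsum_finsetSum fun j _ => (summable_bary j ω).smul_const (q j)]
  congr 1
  ext1 n
  simp [ite_smul]

lemma continuous_address (q : Fin 3 → Plane) : Continuous (address q) := by
  have : address q = fun ω => ∑ j, bary j ω • q j := funext (address_eq_sum q)
  rw [this]
  exact continuous_finsetSum _ fun j _ => (continuous_bary j).smul continuous_const

lemma F_apply (q : Fin 3 → Plane) (i : Fin 3) (y : Plane) :
    F q i y = (1 / 2 : ℝ) • (y + q i) := by
  simp only [F, AffineMap.homothety_apply, vsub_eq_sub, vadd_eq_add]
  module

lemma F_address (q : Fin 3 → Plane) (i : Fin 3) (ω : ℕ → Fin 3) :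
    F q i (address q ω) = address q (consSeq i ω) := by
  rw [F_apply, address_eq_sum, address_eq_sum]
  simp only [Fin.sum_univ_three, bary_consSeq]
  fin_cases i <;> simp <;> module

lemma F_injective (q : Fin 3 → Plane) (i : Fin 3) : Function.Injective (F q i) := by
  intro y z h
  rw [F_apply, F_apply] at h
  exact add_right_cancel (smul_right_injective _ (by norm_num : (1 / 2 : ℝ) ≠ 0) h)

lemma F_corner_comm (q : Fin 3 → Plane) (i j : Fin 3) : F q i (q j) = F q j (q i) := by
  rw [F_apply, F_apply, add_comm]

lemma F_corner_self (q : Fin 3 → Plane) (i : Fin 3) : F q i (q i) = q i := by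
  rw [F_apply]
  module

lemma consSeq_head_tail (ω : ℕ → Fin 3) : consSeq (ω 0) (fun n => ω (n + 1)) = ω := by
  ext n
  cases n <;> rfl

lemma F_mem_gasket (i : Fin 3) {y : Plane} (hy : y ∈ gasket q) : F q i y ∈ gasket q := by
  obtain ⟨ω, rfl⟩ := hy
  exact ⟨_, (F_address q i ω).symm⟩

lemma exists_F_eq {y : Plane} (hy : y ∈ gasket q) : ∃ i, ∃ z ∈ gasket q, F q i z = y := by
  obtain ⟨ω, rfl⟩ := hy
  exact ⟨ω 0, _, ⟨fun n => ω (n + 1), rfl⟩, by rw [F_address, consSeq_head_tail]⟩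

lemma isCompact_gasket (q : Fin 3 → Plane) : IsCompact (gasket q) :=
  isCompact_range (continuous_address q)

lemma address_const (q : Fin 3 → Plane) (i : Fin 3) : address q (fun _ => i) = q i := by
  unfold address
  rw [hasSum_half_pow.summable.tsum_smul_const, hasSum_half_pow.tsum_eq, one_smul]

lemma corner_mem_gasket (q : Fin 3 → Plane) (i : Fin 3) : q i ∈ gasket q :=
  ⟨_, address_const q i⟩

/-! ### Barycentric coordinates in the plane -/

/-- The midpoint of the side opposite to the corner `q j`. -/
def oppMid (q : Fin 3 → Plane) (j : Fin 3) : Plane := midpoint ℝ (q (j + 1)) (q (j + 2))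

/-- The barycentric coordinate with index `j` of a point of the plane. -/
def coord (q : Fin 3 → Plane) (j : Fin 3) (y : Plane) : ℝ :=
  1 - inner ℝ (y - q j) (oppMid q j - q j) / ‖oppMid q j - q j‖ ^ 2

lemma continuous_coord (q : Fin 3 → Plane) (j : Fin 3) : Continuous (coord q j) := by
  unfold coord
  fun_prop

lemma oppMid_sub (q : Fin 3 → Plane) (j : Fin 3) :
    oppMid q j - q j = (1 / 2 : ℝ) • ((q (j + 1) - q j) + (q (j + 2) - q j)) := by
  rw [oppMid, midpoint_eq_smul_add, invOf_eq_inv]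
  module

lemma fin_three_add_one_ne (j : Fin 3) : j + 1 ≠ j := by revert j; decide

lemma fin_three_add_two_ne (j : Fin 3) : j + 2 ≠ j := by revert j; decide

lemma fin_three_add_two_ne_add_one (j : Fin 3) : j + 2 ≠ j + 1 := by revert j; decide

lemma fin_three_cases (i j : Fin 3) : i = j ∨ i = j + 1 ∨ i = j + 2 := by revert i j; decide

lemma fin_three_sum (f : Fin 3 → ℝ) (j : Fin 3) : ∑ i, f i = f j + f (j + 1) + f (j + 2) := by
  fin_cases j
  · exact Fin.sum_univ_three f
  · change _ = f 1 + f 2 + f 0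
    rw [Fin.sum_univ_three]
    ring
  · change _ = f 2 + f 0 + f 1
    rw [Fin.sum_univ_three]
    ring

namespace IsEquilateral

lemma inner_self (hq : IsEquilateral q s) {i j : Fin 3} (h : i ≠ j) :
    inner ℝ (q i - q j) (q i - q j) = s ^ 2 := by
  rw [real_inner_self_eq_norm_sq, ← dist_eq_norm, hq.dist_eq i j h]

lemma inner_sides (hq : IsEquilateral q s) (j : Fin 3) :
    inner ℝ (q (j + 1) - q j) (q (j + 2) - q j) = s ^ 2 / 2 := by
  have h := hq.inner_self (fin_three_add_two_ne_add_one j)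
  have e : q (j + 2) - q (j + 1) = (q (j + 2) - q j) - (q (j + 1) - q j) := by abel
  rw [e, real_inner_sub_sub_self, hq.inner_self (fin_three_add_two_ne j),
    hq.inner_self (fin_three_add_one_ne j), real_inner_comm] at h
  linarith

lemma inner_axis (hq : IsEquilateral q s) (i j : Fin 3) :
    inner ℝ (q i - q j) (oppMid q j - q j) = if i = j then 0 else 3 / 4 * s ^ 2 := by
  rw [oppMid_sub]
  have h := hq.inner_sides j
  have h1 := hq.inner_self (fin_three_add_one_ne j)
  have h2 := hq.inner_self (fin_three_add_two_ne j)
  rcases fin_three_cases i j with rfl | rfl | rfl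
  · simp
  · rw [if_neg (fin_three_add_one_ne j), inner_smul_right, inner_add_right, h, h1]
    ring
  · rw [if_neg (fin_three_add_two_ne j), inner_smul_right, inner_add_right, h2,
      real_inner_comm, h]
    ring

lemma norm_axis_sq (hq : IsEquilateral q s) (j : Fin 3) :
    ‖oppMid q j - q j‖ ^ 2 = 3 / 4 * s ^ 2 := by
  rw [← real_inner_self_eq_norm_sq]
  nth_rw 1 [oppMid_sub]
  rw [inner_smul_left, inner_add_left, hq.inner_axis, hq.inner_axis,
    if_neg (fin_three_add_one_ne j), if_neg (fin_three_add_two_ne j)]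
  simp
  ring

lemma norm_axis (hq : IsEquilateral q s) (j : Fin 3) :
    ‖oppMid q j - q j‖ = √3 / 2 * s := by
  have h := hq.norm_axis_sq j
  have h3 : √3 ^ 2 = (3 : ℝ) := Real.sq_sqrt (by norm_num)
  have hs := hq.pos
  refine (pow_left_inj₀ (norm_nonneg _) (by positivity) two_ne_zero).1 ?_
  rw [h, mul_pow, div_pow, h3]
  ring

lemma coord_corner (hq : IsEquilateral q s) (i j : Fin 3) :
    coord q j (q i) = if i = j then 1 else 0 := by
  have hs := hq.pos
  rw [coord, hq.inner_axis, hq.norm_axis_sq]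
  split_ifs
  · simp
  · field_simp
    simp

lemma coord_sum (hq : IsEquilateral q s) (b : Fin 3 → ℝ) (hb : ∑ i, b i = 1) (j : Fin 3) :
    coord q j (∑ i, b i • q i) = b j := by
  have h : ∑ i, b i • q i - q j = ∑ i, b i • (q i - q j) := by
    simp only [smul_sub, Finset.sum_sub_distrib, ← Finset.sum_smul, hb, one_smul]
  have hs := hq.pos
  rw [coord, h, sum_inner]
  simp only [inner_smul_left, hq.inner_axis, hq.norm_axis_sq]
  rw [fin_three_sum _ j, if_pos rfl, if_neg (fin_three_add_one_ne j),
    if_neg (fin_three_add_two_ne j)]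
  rw [fin_three_sum _ j] at hb
  have : b j = 1 - (b (j + 1) + b (j + 2)) := by linarith
  rw [this]
  field_simp
  simp
  ring

/-- The bridge from geometry to digits: cutting by a line perpendicular to an axis becomes a
condition on the series `bary`. -/
lemma coord_address (hq : IsEquilateral q s) (j : Fin 3) (ω : ℕ → Fin 3) :
    coord q j (address q ω) = bary j ω := by
  rw [address_eq_sum, hq.coord_sum _ (sum_bary ω)]

lemma coord_F (hq : IsEquilateral q s) (i j : Fin 3) (y : Plane) :
    coord q j (F q i y) = (coord q j y + if i = j then 1 else 0) / 2 := by
  rw [← hq.coord_corner i j, F_apply]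
  have h : (1 / 2 : ℝ) • (y + q i) - q j = (1 / 2 : ℝ) • ((y - q j) + (q i - q j)) := by module
  rw [coord, h, inner_smul_left, inner_add_left, coord, coord]
  simp
  ring

lemma coord_nonneg (hq : IsEquilateral q s) (j : Fin 3) {y : Plane} (hy : y ∈ gasket q) :
    0 ≤ coord q j y := by
  obtain ⟨ω, rfl⟩ := hy
  rw [hq.coord_address]
  exact bary_nonneg j ω

lemma coord_le_one (hq : IsEquilateral q s) (j : Fin 3) {y : Plane} (hy : y ∈ gasket q) :
    coord q j y ≤ 1 := by
  obtain ⟨ω, rfl⟩ := hy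
  rw [hq.coord_address]
  exact bary_le_one j ω

lemma eq_corner_of_coord (hq : IsEquilateral q s) {j : Fin 3} {y : Plane} (hy : y ∈ gasket q)
    (h : coord q j y = 1) : y = q j := by
  obtain ⟨ω, rfl⟩ := hy
  rw [hq.coord_address] at h
  have hsum := sum_bary ω
  rw [fin_three_sum _ j] at hsum
  have h1 : bary (j + 1) ω = 0 := by linarith [bary_nonneg (j + 1) ω, bary_nonneg (j + 2) ω]
  have h2 : bary (j + 2) ω = 0 := by linarith [bary_nonneg (j + 1) ω, bary_nonneg (j + 2) ω]
  rw [address_eq_sum]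
  rw [Finset.sum_eq_single j, h, one_smul]
  · intro i _ hi
    rcases fin_three_cases i j with rfl | rfl | rfl
    · exact absurd rfl hi
    · rw [h1, zero_smul]
    · rw [h2, zero_smul]
  · simp

lemma corner_injective (hq : IsEquilateral q s) : Function.Injective q := by
  intro i j h
  by_contra hne
  have := hq.dist_eq i j hne
  rw [h, dist_self] at this
  exact hq.pos.ne this

/-! ### Intersections of cells -/

/-- Two different cells of level one meet in a corner of both. -/
lemma eq_corner_of_F_eq (hq : IsEquilateral q s) {i j : Fin 3} (hij : i ≠ j) {y z : Plane}
    (hy : y ∈ gasket q) (hz : z ∈ gasket q) (h : F q i y = F q j z) : y = q j ∧ z = q i := by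
  -- Coordinate `i` is at least 1/2 on the image of `F q i` and at most 1/2 on that of `F q j`, and
  -- conversely for coordinate `j`; equality forces coordinate value 1 before the contraction.
  have h1 := congrArg (coord q i) h
  have h2 := congrArg (coord q j) h
  rw [hq.coord_F, hq.coord_F] at h1 h2
  simp only [if_true, if_neg hij, if_neg hij.symm] at h1 h2
  constructor
  · apply hq.eq_corner_of_coord hy
    linarith [hq.coord_nonneg j hz, hq.coord_le_one j hy]
  · apply hq.eq_corner_of_coord hz
    linarith [hq.coord_nonneg i hy, hq.coord_le_one i hz]

end IsEquilateral

/-! ### The maps `F_w` and their cells -/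

lemma Fw_cons (q : Fin 3 → Plane) (i : Fin 3) (w : List (Fin 3)) (y : Plane) :
    Fw q (i :: w) y = F q i (Fw q w y) := rfl

lemma Fw_append (q : Fin 3 → Plane) (w v : List (Fin 3)) (y : Plane) :
    Fw q (w ++ v) y = Fw q w (Fw q v y) := by
  induction w with
  | nil => rfl
  | cons i w ih => rw [List.cons_append, Fw_cons, ih, Fw_cons]

lemma Fw_snoc (q : Fin 3 → Plane) (w : List (Fin 3)) (i : Fin 3) (y : Plane) :
    Fw q (w ++ [i]) y = Fw q w (F q i y) := Fw_append q w [i] y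

lemma Fw_injective (q : Fin 3 → Plane) (w : List (Fin 3)) : Function.Injective (Fw q w) := by
  induction w with
  | nil => exact Function.injective_id
  | cons i w ih => exact (F_injective q i).comp ih

lemma Fw_mem_gasket (w : List (Fin 3)) {y : Plane} (hy : y ∈ gasket q) : Fw q w y ∈ gasket q := by
  induction w with
  | nil => exact hy
  | cons i w ih => exact F_mem_gasket i ih

lemma Fw_sub (q : Fin 3 → Plane) (w : List (Fin 3)) (y z : Plane) :
    Fw q w y - Fw q w z = (1 / 2 : ℝ) ^ w.length • (y - z) := by
  induction w with
  | nil => simp [Fw]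
  | cons i w ih =>
    rw [Fw_cons, Fw_cons, F_apply, F_apply, ← smul_sub, add_sub_add_right_eq_sub, ih,
      List.length_cons, pow_succ, smul_smul, mul_comm]

lemma dist_Fw (q : Fin 3 → Plane) (w : List (Fin 3)) (y z : Plane) :
    dist (Fw q w y) (Fw q w z) = (1 / 2 : ℝ) ^ w.length * dist y z := by
  rw [dist_eq_norm, dist_eq_norm, Fw_sub, norm_smul, Real.norm_of_nonneg (by positivity)]

lemma continuous_Fw (q : Fin 3 → Plane) (w : List (Fin 3)) : Continuous (Fw q w) := by
  induction w with
  | nil => exact continuous_id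
  | cons i w ih =>
    have : Continuous (F q i) := by
      have : F q i = fun y => (1 / 2 : ℝ) • (y + q i) := funext (F_apply q i)
      rw [this]
      fun_prop
    exact this.comp ih

lemma Fw_midpoint (q : Fin 3 → Plane) (w : List (Fin 3)) (y z : Plane) :
    Fw q w (midpoint ℝ y z) = midpoint ℝ (Fw q w y) (Fw q w z) := by
  induction w with
  | nil => rfl
  | cons i w ih =>
    rw [Fw_cons, Fw_cons, Fw_cons, ih]
    simp only [F_apply, midpoint_eq_smul_add, invOf_eq_inv]
    module

lemma cell_subset_gasket (q : Fin 3 → Plane) (w : List (Fin 3)) : cell q w ⊆ gasket q := by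
  rintro _ ⟨y, hy, rfl⟩
  exact Fw_mem_gasket w hy

lemma isCompact_cell (q : Fin 3 → Plane) (w : List (Fin 3)) : IsCompact (cell q w) :=
  (isCompact_gasket q).image (continuous_Fw q w)

lemma exists_mem_cell_snoc {w : List (Fin 3)} {x : Plane} (hx : x ∈ cell q w) :
    ∃ i, x ∈ cell q (w ++ [i]) := by
  obtain ⟨y, hy, rfl⟩ := hx
  obtain ⟨i, z, hz, rfl⟩ := exists_F_eq hy
  exact ⟨i, z, hz, Fw_snoc q w i z⟩

lemma cell_snoc_subset (q : Fin 3 → Plane) (w : List (Fin 3)) (i : Fin 3) :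
    cell q (w ++ [i]) ⊆ cell q w := by
  rintro _ ⟨y, hy, rfl⟩
  exact ⟨F q i y, F_mem_gasket i hy, (Fw_snoc q w i y).symm⟩

lemma exists_mem_cell {x : Plane} (hx : x ∈ gasket q) (k : ℕ) :
    ∃ w : List (Fin 3), w.length = k ∧ x ∈ cell q w := by
  induction k with
  | zero => exact ⟨[], rfl, x, hx, rfl⟩
  | succ k ih =>
    obtain ⟨w, hw, hxw⟩ := ih
    obtain ⟨i, hi⟩ := exists_mem_cell_snoc hxw
    exact ⟨w ++ [i], by simp [hw], hi⟩

lemma Fw_replicate_corner (q : Fin 3 → Plane) (n : ℕ) (j : Fin 3) :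
    Fw q (List.replicate n j) (q j) = q j := by
  induction n with
  | zero => rfl
  | succ n ih => rw [List.replicate_succ, Fw_cons, ih, F_corner_self]

namespace IsEquilateral

/-- A first letter `i ≠ j` would put `q j = F_j q_j` into two level-one cells, whose common point
forces `q j = q i`. So a corner of the gasket has only the constant address. -/
lemma eq_replicate_of_Fw_eq_corner (hq : IsEquilateral q s) {j : Fin 3} :
    ∀ {w : List (Fin 3)} {y : Plane}, y ∈ gasket q → Fw q w y = q j →
      w = List.replicate w.length j ∧ y = q j
  | [], y, _, h => ⟨rfl, h⟩
  | i :: w, y, hy, h => by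
    have hm := Fw_mem_gasket w hy
    by_cases hij : i = j
    · subst hij
      have h' : Fw q w y = q i := by
        apply F_injective q i
        rw [F_corner_self, ← h, Fw_cons]
      obtain ⟨h1, h2⟩ := hq.eq_replicate_of_Fw_eq_corner hy h'
      exact ⟨by rw [List.length_cons, List.replicate_succ, ← h1], h2⟩
    · rw [Fw_cons, ← F_corner_self q j] at h
      have h2 := (hq.eq_corner_of_F_eq hij hm (corner_mem_gasket q j) h).2
      exact absurd (hq.corner_injective h2).symm hij

/-- A common point of two different cells of one level is a corner of both. -/
lemma exists_corner_of_Fw_eq (hq : IsEquilateral q s) :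
    ∀ {w v : List (Fin 3)} {y z : Plane}, w.length = v.length → w ≠ v → y ∈ gasket q →
      z ∈ gasket q → Fw q w y = Fw q v z → (∃ j, y = q j) ∧ ∃ i, z = q i
  | [], [], _, _, _, hne, _, _, _ => absurd rfl hne
  | [], _ :: _, _, _, hl, _, _, _, _ => by simp at hl
  | _ :: _, [], _, _, hl, _, _, _, _ => by simp at hl
  | a :: w, b :: v, y, z, hl, hne, hy, hz, h => by
    by_cases hab : a = b
    · subst hab
      exact hq.exists_corner_of_Fw_eq (by simpa using hl) (by simpa using hne) hy hz
        (F_injective q a h)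
    · obtain ⟨h1, h2⟩ := hq.eq_corner_of_F_eq hab (Fw_mem_gasket w hy) (Fw_mem_gasket v hz) h
      exact ⟨⟨b, (hq.eq_replicate_of_Fw_eq_corner hy h1).2⟩,
        ⟨a, (hq.eq_replicate_of_Fw_eq_corner hz h2).2⟩⟩

/-- Strip the common prefix; at the first differing letters `a`, `b` the only possible common point
is `F_a q_b`. -/
lemma cell_inter_subsingleton (hq : IsEquilateral q s) :
    ∀ {w v : List (Fin 3)}, w.length = v.length → w ≠ v →
      (cell q w ∩ cell q v).Subsingleton
  | [], [], _, hne => absurd rfl hne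
  | [], _ :: _, hl, _ => by simp at hl
  | _ :: _, [], hl, _ => by simp at hl
  | a :: w, b :: v, hl, hne => by
    rintro _ ⟨⟨y, hy, rfl⟩, ⟨z, hz, h⟩⟩ _ ⟨⟨y', hy', rfl⟩, ⟨z', hz', h'⟩⟩
    rw [Fw_cons, Fw_cons] at h h' ⊢
    congr 1
    by_cases hab : a = b
    · subst hab
      exact hq.cell_inter_subsingleton (w := w) (v := v) (by simpa using hl) (by simpa using hne)
        ⟨⟨y, hy, rfl⟩, ⟨z, hz, F_injective q a h⟩⟩ ⟨⟨y', hy', rfl⟩, ⟨z', hz', F_injective q a h'⟩⟩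
    · rw [(hq.eq_corner_of_F_eq hab (Fw_mem_gasket w hy) (Fw_mem_gasket v hz) h.symm).1,
        (hq.eq_corner_of_F_eq hab (Fw_mem_gasket w hy') (Fw_mem_gasket v hz') h'.symm).1]

/-- No point lies in three different cells of one level. -/
lemma eq_or_eq_of_mem_cells (hq : IsEquilateral q s) :
    ∀ {w v u : List (Fin 3)} {x : Plane}, w.length = v.length → u.length = v.length → w ≠ v →
      x ∈ cell q w → x ∈ cell q v → x ∈ cell q u → u = w ∨ u = v
  | [], [], _, _, _, _, hne, _, _, _ => absurd rfl hne
  | [], _ :: _, _, _, hl, _, _, _, _, _ => by simp at hl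
  | _ :: _, [], _, _, hl, _, _, _, _, _ => by simp at hl
  | _ :: _, _ :: _, [], _, _, hl, _, _, _, _ => by simp at hl
  | a :: w, b :: v, c :: u, x, hl, hl', hne, hw, hv, hu => by
    obtain ⟨y, hy, rfl⟩ := hw
    obtain ⟨z, hz, hzy⟩ := hv
    obtain ⟨t, ht, hty⟩ := hu
    simp only [List.length_cons, Nat.add_right_cancel_iff] at hl hl'
    rw [Fw_cons, Fw_cons] at hzy hty
    have hty' := hty.trans hzy.symm
    have hw := Fw_mem_gasket w hy
    have hv := Fw_mem_gasket v hz
    have hu := Fw_mem_gasket u ht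
    by_cases hab : a = b
    · subst hab
      by_cases hca : c = a
      · subst hca
        rcases hq.eq_or_eq_of_mem_cells (w := w) (v := v) (u := u) hl hl' (by simpa using hne)
          ⟨y, hy, rfl⟩ ⟨z, hz, F_injective q c hzy⟩ ⟨t, ht, F_injective q c hty⟩ with h | h
        · exact Or.inl (by rw [h])
        · exact Or.inr (by rw [h])
      -- After removing the common letter `a`, the point is `q c`. Its address is constant, so `w`
      -- and `v` would coincide.
      · have e1 := (hq.eq_replicate_of_Fw_eq_corner hy (hq.eq_corner_of_F_eq hca hu hw hty).2).1
        have e2 := (hq.eq_replicate_of_Fw_eq_corner hz (hq.eq_corner_of_F_eq hca hu hv hty').2).1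
        rw [hl, ← e2] at e1
        exact absurd (by rw [e1]) hne
    · obtain ⟨h1, h2⟩ := hq.eq_corner_of_F_eq hab hw hv hzy.symm
      by_cases hca : c = a
      · subst hca
        have e1 := (hq.eq_replicate_of_Fw_eq_corner hy h1).1
        have e2 := (hq.eq_replicate_of_Fw_eq_corner ht ((F_injective q c hty).trans h1)).1
        rw [hl'.trans hl.symm, ← e1] at e2
        exact Or.inl (by rw [e2])
      -- The preimage of the point under `F q a` is both `q b` and `q c`, so `c = b`: only two
      -- level-one cells meet there.
      · have hcb := hq.corner_injective (h1.symm.trans (hq.eq_corner_of_F_eq hca hu hw hty).2)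
        subst hcb
        have e1 := (hq.eq_replicate_of_Fw_eq_corner hz h2).1
        have e2 := (hq.eq_replicate_of_Fw_eq_corner ht ((F_injective q b hty').trans h2)).1
        rw [hl', ← e1] at e2
        exact Or.inr (by rw [e2])

/-! ### Junction points and the mean value equation at them -/

/-- A corner of a cell that is not a corner of the gasket is a corner of another cell of the same
level. -/
lemma exists_neighbor (hq : IsEquilateral q s) (j : Fin 3) :
    ∀ w : List (Fin 3), Fw q w (q j) = q j ∨
      ∃ v : List (Fin 3), ∃ i, v.length = w.length ∧ v ≠ w ∧ Fw q v (q i) = Fw q w (q j)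
  | [] => Or.inl rfl
  | a :: w => by
    rcases hq.exists_neighbor j w with h | ⟨v, i, hl, hne, h⟩
    · by_cases haj : a = j
      · subst haj
        exact Or.inl (by rw [Fw_cons, h, F_corner_self])
      -- Here the point is `F_a q_j = F_j q_a`, and `q a` is a corner of the cell with word `aa…a`.
      · refine Or.inr ⟨j :: List.replicate w.length a, a, by simp, ?_, ?_⟩
        · intro e
          exact haj (List.cons_eq_cons.1 e).1.symm
        · rw [Fw_cons, Fw_cons, Fw_replicate_corner, h, F_corner_comm]
    · exact Or.inr ⟨a :: v, i, by simp [hl], by simpa using hne, by rw [Fw_cons, h, Fw_cons]⟩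

lemma cell_inter_eq (hq : IsEquilateral q s) {w v : List (Fin 3)} {i j : Fin 3}
    (hl : v.length = w.length) (hne : v ≠ w) (h : Fw q v (q i) = Fw q w (q j)) :
    cell q v ∩ cell q w = {Fw q w (q j)} :=
  (hq.cell_inter_subsingleton hl hne).eq_singleton_of_mem
    ⟨⟨q i, corner_mem_gasket q i, h⟩, ⟨q j, corner_mem_gasket q j, rfl⟩⟩

/-- The neighbours of a vertex of `Γ_m` that is not a corner of the gasket. -/
lemma neighborSet_eq (hq : IsEquilateral q s) {w v : List (Fin 3)} {i j : Fin 3}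
    (hl : v.length = w.length) (hne : v ≠ w) (h : Fw q v (q i) = Fw q w (q j)) :
    (graph q w.length).neighborSet (Fw q w (q j)) =
      (({Fw q w (q (j + 1)), Fw q w (q (j + 2)), Fw q v (q (i + 1)), Fw q v (q (i + 2))} :
        Finset Plane) : Set Plane) := by
  have hw : Function.Injective fun l => Fw q w (q l) := (Fw_injective q w).comp hq.corner_injective
  have hv : Function.Injective fun l => Fw q v (q l) := (Fw_injective q v).comp hq.corner_injective
  ext y
  simp only [SimpleGraph.mem_neighborSet, graph, boundary, Finset.coe_insert,
    Finset.coe_singleton, Set.mem_insert_iff, Set.mem_singleton_iff]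
  constructor
  · rintro ⟨hxy, u, hu, ⟨_, ⟨l, rfl⟩, hlx⟩, ⟨_, ⟨l', rfl⟩, rfl⟩⟩
    rcases hq.eq_or_eq_of_mem_cells hl.symm (hu.trans hl.symm) hne.symm
      ⟨q j, corner_mem_gasket q j, rfl⟩ ⟨q i, corner_mem_gasket q i, h⟩
      ⟨q l, corner_mem_gasket q l, hlx⟩ with rfl | rfl
    · rcases fin_three_cases l' j with rfl | rfl | rfl
      · exact absurd rfl hxy
      · simp
      · simp
    · rcases fin_three_cases l' i with rfl | rfl | rfl
      · exact absurd h.symm hxy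
      · simp
      · simp
  · have aw : ∀ l, l ≠ j → Fw q w (q j) ≠ Fw q w (q l) := fun l hlj e => hlj (hw e).symm
    have av : ∀ l, l ≠ i → Fw q w (q j) ≠ Fw q v (q l) := fun l hli e =>
      hli (hv (h.trans e)).symm
    have mw : ∀ l, Fw q w (q l) ∈ Fw q w '' Set.range q := fun l => ⟨_, ⟨l, rfl⟩, rfl⟩
    have mv : ∀ l, Fw q v (q l) ∈ Fw q v '' Set.range q := fun l => ⟨_, ⟨l, rfl⟩, rfl⟩
    rintro (rfl | rfl | rfl | rfl)
    · exact ⟨aw _ (fin_three_add_one_ne j), w, rfl, mw _, mw _⟩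
    · exact ⟨aw _ (fin_three_add_two_ne j), w, rfl, mw _, mw _⟩
    · exact ⟨av _ (fin_three_add_one_ne i), v, hl, h ▸ mv i, mv _⟩
    · exact ⟨av _ (fin_three_add_two_ne i), v, hl, h ▸ mv i, mv _⟩

/-- The mean value equation of a harmonic function at the common corner of two cells. -/
lemma harmonic_corner (hq : IsEquilateral q s) {w v : List (Fin 3)} {i j : Fin 3}
    (hl : v.length = w.length) (hne : v ≠ w) (h : Fw q v (q i) = Fw q w (q j))
    {f : Plane → ℝ} (hf : IsHarmonic q f) (hb : Fw q w (q j) ∉ boundary q) :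
    4 * f (Fw q w (q j)) = f (Fw q w (q (j + 1))) + f (Fw q w (q (j + 2))) +
      f (Fw q v (q (i + 1))) + f (Fw q v (q (i + 2))) := by
  have hw : Function.Injective fun l => Fw q w (q l) := (Fw_injective q w).comp hq.corner_injective
  have hv : Function.Injective fun l => Fw q v (q l) := (Fw_injective q v).comp hq.corner_injective
  have hvw : ∀ l l', l ≠ j → Fw q w (q l) ≠ Fw q v (q l') := by
    intro l l' hlj e
    have : Fw q w (q l) ∈ cell q v ∩ cell q w :=
      ⟨⟨q l', corner_mem_gasket q l', e.symm⟩, ⟨q l, corner_mem_gasket q l, rfl⟩⟩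
    rw [hq.cell_inter_eq hl hne h] at this
    exact hlj (hw this)
  have hm := hf.mean_value w.length (Fw q w (q j)) ⟨⟨w, rfl, q j, ⟨j, rfl⟩, rfl⟩, hb⟩
  -- The sum has four separate terms because the two cells share only the point itself (`hvw`).
  rw [hq.neighborSet_eq hl hne h, finsum_mem_coe_finset, Finset.sum_insert, Finset.sum_insert,
    Finset.sum_insert, Finset.sum_singleton] at hm
  · linarith
  · rw [Finset.mem_singleton]
    exact fun e => fin_three_add_two_ne_add_one i (hv e).symm
  · simp only [Finset.mem_insert, Finset.mem_singleton]
    rintro (e | e) <;> exact hvw _ _ (fin_three_add_two_ne j) e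
  · simp only [Finset.mem_insert, Finset.mem_singleton]
    rintro (e | e | e)
    · exact fin_three_add_two_ne_add_one j (hw e).symm
    · exact hvw _ _ (fin_three_add_one_ne j) e
    · exact hvw _ _ (fin_three_add_one_ne j) e

end IsEquilateral

/-! ### The self-similar measure -/

/-- The law of a sequence of independent uniformly distributed digits. -/
def seqMeasure : Measure (ℕ → Fin 3) :=
  Measure.infinitePi fun _ : ℕ => (PMF.uniformOfFintype (Fin 3)).toMeasure

instance : IsProbabilityMeasure seqMeasure := by
  unfold seqMeasure
  infer_instance

lemma measurable_consSeq (i : Fin 3) : Measurable (consSeq i) := by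
  refine measurable_pi_iff.2 fun n => ?_
  cases n with
  | zero => exact measurable_const
  | succ n => exact measurable_pi_apply n

/-- The first digit is uniform and independent of the remaining ones, which have the same joint law.
It suffices to compare the measures on cylinders. -/
lemma seqMeasure_eq :
    seqMeasure = (3⁻¹ : ENNReal) • ∑ i, seqMeasure.map (consSeq i) := by
  symm
  refine Measure.eq_infinitePi _ fun S t ht => ?_
  have key : ∀ (N : ℕ) (t : ℕ → Set (Fin 3)),
      ((3⁻¹ : ENNReal) • ∑ i, seqMeasure.map (consSeq i)) (Set.pi (Finset.range (N + 1)) t) =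
        ∏ n ∈ Finset.range (N + 1), (PMF.uniformOfFintype (Fin 3)).toMeasure (t n) := by
    intro N t
    have hpre : ∀ i, seqMeasure.map (consSeq i) (Set.pi (Finset.range (N + 1)) t) =
        (t 0).indicator 1 i *
          ∏ n ∈ Finset.range N, (PMF.uniformOfFintype (Fin 3)).toMeasure (t (n + 1)) := by
      intro i
      rw [Measure.map_apply (measurable_consSeq i)
        (.pi (Finset.countable_toSet _) fun _ _ => .of_discrete)]
      by_cases hi : i ∈ t 0
      · rw [Set.indicator_of_mem hi, Pi.one_apply, one_mul, ← Measure.infinitePi_pi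
          (μ := fun _ : ℕ => (PMF.uniformOfFintype (Fin 3)).toMeasure)
          (t := fun n => t (n + 1)) fun _ _ => .of_discrete]
        congr 1
        ext ω
        simp only [Set.mem_preimage, Set.mem_pi, Finset.coe_range, Set.mem_Iio]
        constructor
        · exact fun h n hn => h (n + 1) (by omega)
        · intro h n hn
          cases n with
          | zero => exact hi
          | succ n => exact h n (by omega)
      · rw [Set.indicator_of_notMem hi, zero_mul]
        convert measure_empty (μ := seqMeasure)
        ext ω
        simp only [Set.mem_preimage, Set.mem_pi, Set.mem_empty_iff_false, iff_false]
        exact fun h => hi (h 0 (by simp))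
    rw [Finset.prod_range_succ', Measure.smul_apply, Measure.finsetSum_apply, mul_comm,
      PMF.toMeasure_apply_fintype, smul_eq_mul]
    simp only [hpre]
    rw [← Finset.sum_mul, ← mul_assoc, Finset.mul_sum]
    congr 1
    refine Finset.sum_congr rfl fun i _ => ?_
    by_cases hi : i ∈ t 0 <;> simp [hi]
  obtain ⟨N, hN⟩ : ∃ N, S ⊆ Finset.range (N + 1) :=
    ⟨S.sup id, fun n hn => Finset.mem_range.2 (Nat.lt_succ_of_le (Finset.le_sup (f := id) hn))⟩
  -- A cylinder over an arbitrary finite set is padded with full factors to one over an initial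
  -- segment, where removing the first digit is a shift.
  have h := key N fun n => if n ∈ S then t n else Set.univ
  have hset : Set.pi (Finset.range (N + 1) : Set ℕ) (fun n => if n ∈ S then t n else Set.univ)
      = Set.pi (S : Set ℕ) t := by
    ext ω
    simp only [Set.mem_pi, Finset.mem_coe]
    constructor
    · intro h n hn
      simpa [hn] using h n (hN hn)
    · intro h n _
      split_ifs with hn
      · exact h n hn
      · trivial
  rw [hset] at h
  rw [h, ← Finset.prod_subset hN]
  · exact Finset.prod_congr rfl fun n hn => by rw [if_pos hn]
  · intro n _ hn
    rw [if_neg hn, measure_univ]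

lemma seqMeasure_apply {S : Set (ℕ → Fin 3)} (hS : MeasurableSet S) :
    seqMeasure S = 3⁻¹ * ∑ i, seqMeasure (consSeq i ⁻¹' S) := by
  conv_lhs => rw [seqMeasure_eq]
  rw [Measure.smul_apply, Measure.finsetSum_apply, smul_eq_mul]
  congr 1
  exact Finset.sum_congr rfl fun i _ => Measure.map_apply (measurable_consSeq i) hS

lemma seqMeasure_map_perm (σ : Equiv.Perm (Fin 3)) :
    seqMeasure.map (fun ω => σ ∘ ω) = seqMeasure := by
  unfold seqMeasure
  have h := Measure.infinitePi_map_pi (ι := ℕ)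
    (fun _ : ℕ => (PMF.uniformOfFintype (Fin 3)).toMeasure) (f := fun _ => σ)
    (fun _ => .of_discrete)
  have h' : (PMF.uniformOfFintype (Fin 3)).toMeasure.map σ =
      (PMF.uniformOfFintype (Fin 3)).toMeasure := by
    refine Measure.ext_of_singleton fun i => ?_
    rw [Measure.map_apply .of_discrete .of_discrete]
    have : σ ⁻¹' {i} = {σ.symm i} := by
      ext j
      simp [Equiv.eq_symm_apply]
    rw [this, PMF.toMeasure_apply_singleton _ _ .of_discrete,
      PMF.toMeasure_apply_singleton _ _ .of_discrete]
    simp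
  simp only [h'] at h
  exact h

lemma measurable_bary (j : Fin 3) : Measurable (bary j) := (continuous_bary j).measurable

lemma measureReal_bary_eq_rec (j : Fin 3) (t : ℝ) :
    seqMeasure.real {ω | bary j ω = t} = (seqMeasure.real {ω | bary j ω = 2 * t - 1} +
      2 * seqMeasure.real {ω | bary j ω = 2 * t}) / 3 := by
  have hm : MeasurableSet {ω | bary j ω = t} := measurable_bary j (measurableSet_singleton t)
  have h : ∀ i, consSeq i ⁻¹' {ω | bary j ω = t} =
      {ω | bary j ω = 2 * t - if i = j then 1 else 0} := by
    intro i
    ext ω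
    simp only [Set.mem_preimage, Set.mem_ofPred_eq, bary_consSeq]
    constructor <;> intro h <;> linarith
  rw [measureReal_def, seqMeasure_apply hm, ENNReal.toReal_mul,
    ENNReal.toReal_sum fun _ _ => measure_ne_top _ _]
  simp only [h]
  rw [fin_three_sum _ j, if_pos rfl, if_neg (fin_three_add_one_ne j),
    if_neg (fin_three_add_two_ne j)]
  simp only [sub_zero, ← measureReal_def]
  simp
  ring

/-- The atom masses satisfy `p t = (p (2t-1) + 2 p (2t)) / 3`. For `t ≠ 1/2` one of the two
arguments lies outside `[0, 1]`, so a uniform bound on `p` improves by the factor 2/3; for `t = 1/2`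
the arguments are 0 and 1, where `p` vanishes. -/
lemma measure_bary_eq (j : Fin 3) (t : ℝ) : seqMeasure {ω | bary j ω = t} = 0 := by
  set p : ℝ → ℝ := fun t => seqMeasure.real {ω | bary j ω = t} with hp
  have hrec : ∀ t, p t = (p (2 * t - 1) + 2 * p (2 * t)) / 3 := measureReal_bary_eq_rec j
  have hlt : ∀ t, t < 0 → p t = 0 := by
    intro t ht
    have : {ω | bary j ω = t} = ∅ := by
      ext ω
      simp only [Set.mem_ofPred_eq, Set.mem_empty_iff_false, iff_false]
      exact fun h => absurd (bary_nonneg j ω) (by linarith)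
    simp [hp, this]
  have hgt : ∀ t, 1 < t → p t = 0 := by
    intro t ht
    have : {ω | bary j ω = t} = ∅ := by
      ext ω
      simp only [Set.mem_ofPred_eq, Set.mem_empty_iff_false, iff_false]
      exact fun h => absurd (bary_le_one j ω) (by linarith)
    simp [hp, this]
  have h0 : p 0 = 0 := by
    have h := hrec 0
    norm_num at h
    have := hlt (-1) (by norm_num)
    linarith
  have h1 : p 1 = 0 := by
    have h := hrec 1
    norm_num at h
    have := hgt 2 (by norm_num)
    linarith
  have hle : ∀ n : ℕ, ∀ t, p t ≤ (2 / 3) ^ n := by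
    intro n
    induction n with
    | zero =>
      intro t
      rw [pow_zero]
      exact measureReal_le_one
    | succ n ih =>
      intro t
      have hn : (0 : ℝ) ≤ (2 / 3) ^ n := by positivity
      rw [hrec t, pow_succ]
      rcases lt_trichotomy t (1 / 2) with ht | ht | ht
      · rw [hlt (2 * t - 1) (by linarith)]
        linarith [ih (2 * t)]
      · subst ht
        norm_num [h0, h1]
      · rw [hgt (2 * t) (by linarith)]
        linarith [ih (2 * t - 1)]
  have hle0 : p t ≤ 0 := ge_of_tendsto'
    (tendsto_pow_atTop_nhds_zero_of_lt_one (by norm_num : (0 : ℝ) ≤ 2 / 3) (by norm_num))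
    fun n => hle n t
  exact (measureReal_eq_zero_iff).1 (le_antisymm hle0 measureReal_nonneg)

lemma measurable_address (q : Fin 3 → Plane) : Measurable (address q) :=
  (continuous_address q).measurable

instance (q : Fin 3 → Plane) : IsProbabilityMeasure (gasketMeasure q) :=
  Measure.isProbabilityMeasure_map (measurable_address q).aemeasurable

lemma gasketMeasure_apply (q : Fin 3 → Plane) {S : Set Plane} (hS : MeasurableSet S) :
    gasketMeasure q S = seqMeasure (address q ⁻¹' S) :=
  Measure.map_apply (measurable_address q) hS

lemma measurableSet_gasket (q : Fin 3 → Plane) : MeasurableSet (gasket q) :=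
  (isCompact_gasket q).isClosed.measurableSet

lemma measurableSet_cell (q : Fin 3 → Plane) (w : List (Fin 3)) : MeasurableSet (cell q w) :=
  (isCompact_cell q w).isClosed.measurableSet

lemma gasketMeasure_compl (q : Fin 3 → Plane) : gasketMeasure q (gasket q)ᶜ = 0 := by
  rw [gasketMeasure_apply q (measurableSet_gasket q).compl]
  convert measure_empty (μ := seqMeasure)
  ext ω
  simp [gasket]

lemma ae_mem_gasket (q : Fin 3 → Plane) : ∀ᵐ x ∂gasketMeasure q, x ∈ gasket q :=
  mem_ae_iff.2 (gasketMeasure_compl q)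

lemma gasketMeasure_inter_gasket (q : Fin 3 → Plane) (S : Set Plane) :
    gasketMeasure q (S ∩ gasket q) = gasketMeasure q S := by
  rw [Set.inter_comm]
  exact Measure.measure_inter_eq_of_ae (ae_mem_gasket q)

lemma IsEquilateral.gasketMeasure_singleton (hq : IsEquilateral q s) (x : Plane) :
    gasketMeasure q {x} = 0 := by
  rw [gasketMeasure_apply q (measurableSet_singleton x)]
  refine measure_mono_null (fun ω hω => ?_) (measure_bary_eq 0 (coord q 0 x))
  rw [Set.mem_ofPred_eq, ← hq.coord_address]
  exact congrArg _ hω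

lemma IsEquilateral.gasketMeasure_subsingleton (hq : IsEquilateral q s) {S : Set Plane}
    (hS : S.Subsingleton) : gasketMeasure q S = 0 := by
  rcases hS.eq_empty_or_singleton with rfl | ⟨x, rfl⟩
  · exact measure_empty
  · exact hq.gasketMeasure_singleton x

lemma measurable_Fw (q : Fin 3 → Plane) (w : List (Fin 3)) : Measurable (Fw q w) :=
  (continuous_Fw q w).measurable

lemma measurable_F (q : Fin 3 → Plane) (i : Fin 3) : Measurable (F q i) :=
  measurable_Fw q [i]

lemma gasketMeasure_rec (q : Fin 3 → Plane) {S : Set Plane} (hS : MeasurableSet S) :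
    gasketMeasure q S = 3⁻¹ * ∑ i, gasketMeasure q (F q i ⁻¹' S) := by
  rw [gasketMeasure_apply q hS, seqMeasure_apply (measurable_address q hS)]
  congr 1
  refine Finset.sum_congr rfl fun i _ => ?_
  rw [gasketMeasure_apply q (measurable_F q i hS)]
  congr 1
  ext ω
  simp [F_address]

/-- In the one-letter recursion only the letter of the cell contributes: the other two preimages
meet the gasket in at most one corner, a null set. -/
lemma IsEquilateral.gasketMeasure_subset_cell (hq : IsEquilateral q s) :
    ∀ {v : List (Fin 3)} {S : Set Plane}, MeasurableSet S → S ⊆ cell q v →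
      gasketMeasure q S = 3⁻¹ ^ v.length * gasketMeasure q (Fw q v ⁻¹' S)
  | [], S, _, _ => by simp [Fw]
  | i :: v, S, hS, hsub => by
    rw [gasketMeasure_rec q hS, Finset.sum_eq_single i]
    · rw [hq.gasketMeasure_subset_cell (v := v) (measurable_F q i hS), List.length_cons, pow_succ',
        mul_assoc]
      · rfl
      · intro y hy
        obtain ⟨z, hz, hzy⟩ := hsub hy
        exact ⟨z, hz, F_injective q i hzy⟩
    · intro j _ hji
      rw [← gasketMeasure_inter_gasket]
      apply hq.gasketMeasure_subsingleton
      have : F q j ⁻¹' S ∩ gasket q ⊆ {q i} := by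
        rintro y ⟨hy, hyg⟩
        obtain ⟨z, hz, hzy⟩ := hsub hy
        exact (hq.eq_corner_of_F_eq hji hyg (Fw_mem_gasket v hz) hzy.symm).1
      exact Set.subsingleton_singleton.anti this
    · simp

lemma measurableEmbedding_Fw (q : Fin 3 → Plane) (w : List (Fin 3)) :
    MeasurableEmbedding (Fw q w) :=
  (continuous_Fw q w).measurableEmbedding (Fw_injective q w)

lemma IsEquilateral.gasketMeasure_restrict_cell (hq : IsEquilateral q s) (v : List (Fin 3)) :
    (gasketMeasure q).restrict (cell q v) =
      (3⁻¹ ^ v.length : ENNReal) • (gasketMeasure q).map (Fw q v) := by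
  ext S hS
  rw [Measure.restrict_apply hS, hq.gasketMeasure_subset_cell (hS.inter (measurableSet_cell q v))
    Set.inter_subset_right, Measure.smul_apply, Measure.map_apply (measurable_Fw q v) hS,
    smul_eq_mul, Set.preimage_inter, cell, (Fw_injective q v).preimage_image,
    gasketMeasure_inter_gasket]

lemma IsEquilateral.setIntegral_image (hq : IsEquilateral q s) (v : List (Fin 3)) {D : Set Plane}
    (hD : D ⊆ gasket q) (hDm : MeasurableSet D) (f : Plane → ℝ) :
    ∫ y in Fw q v '' D, f y ∂(gasketMeasure q) =
      3⁻¹ ^ v.length * ∫ y in D, f (Fw q v y) ∂(gasketMeasure q) := by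
  have h1 : Fw q v '' D ⊆ cell q v := Set.image_mono hD
  have hm : MeasurableSet (Fw q v '' D) := (measurableEmbedding_Fw q v).measurableSet_image.2 hDm
  rw [← Set.inter_eq_self_of_subset_left h1, ← Measure.restrict_restrict hm,
    hq.gasketMeasure_restrict_cell, Measure.restrict_smul, integral_smul_measure,
    (measurableEmbedding_Fw q v).setIntegral_map, (Fw_injective q v).preimage_image, smul_eq_mul]
  simp

lemma aestronglyMeasurable_of_continuousOn {f : Plane → ℝ} (hf : ContinuousOn f (gasket q)) :
    AEStronglyMeasurable f (gasketMeasure q) := by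
  have h := hf.aestronglyMeasurable (μ := gasketMeasure q) (measurableSet_gasket q)
  rwa [Measure.restrict_eq_self_of_ae_mem (ae_mem_gasket q)] at h

lemma integrable_of_continuousOn {f : Plane → ℝ} (hf : ContinuousOn f (gasket q)) :
    Integrable f (gasketMeasure q) := by
  have h := hf.integrableOn_compact (μ := gasketMeasure q) (isCompact_gasket q)
  rwa [IntegrableOn, Measure.restrict_eq_self_of_ae_mem (ae_mem_gasket q)] at h

/-! ### Harmonic extension -/

/-- The harmonic extension rule: the values at the corners of the subcell with index `i` of a cell
with corner values `u`. -/
def step (i : Fin 3) (u : Fin 3 → ℝ) : Fin 3 → ℝ :=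
  fun j => if j = i then u i else (u i + u j + ∑ l, u l) / 5

/-- The values at the corners of the cell of level `n` that contains the point with address `ω`, if
the corner values of the gasket are `u`. -/
def cornerVal (u : Fin 3 → ℝ) (ω : ℕ → Fin 3) : ℕ → Fin 3 → ℝ
  | 0 => u
  | n + 1 => step (ω n) (cornerVal u ω n)

/-- The worst case is `u i` against a new value `(2 u i + 2 u j + u l) / 5`: their difference is `(2
(u i - u j) + (u i - u l)) / 5`. -/
lemma step_osc {u : Fin 3 → ℝ} {d : ℝ} (h : ∀ a b, u a - u b ≤ d) (i a b : Fin 3) :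
    step i u a - step i u b ≤ 3 / 5 * d := by
  have h00 := h 0 0
  have h01 := h 0 1
  have h02 := h 0 2
  have h10 := h 1 0
  have h12 := h 1 2
  have h20 := h 2 0
  have h21 := h 2 1
  fin_cases i <;> fin_cases a <;> fin_cases b <;>
    simp [step, Fin.sum_univ_three] <;> linarith

lemma abs_step_sub {u : Fin 3 → ℝ} {d : ℝ} (h : ∀ a b, u a - u b ≤ d) (i a : Fin 3) :
    |step i u a - u a| ≤ d := by
  have h00 := h 0 0
  have h01 := h 0 1
  have h02 := h 0 2
  have h10 := h 1 0
  have h12 := h 1 2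
  have h20 := h 2 0
  have h21 := h 2 1
  rw [abs_le]
  fin_cases i <;> fin_cases a <;>
    simp [step, Fin.sum_univ_three] <;> (try constructor) <;> linarith

lemma exists_osc (u : Fin 3 → ℝ) : ∃ d, ∀ a b, u a - u b ≤ d := by
  refine ⟨∑ a, |u a| + ∑ a, |u a|, fun a b => ?_⟩
  have h : ∀ a, |u a| ≤ ∑ a, |u a| := fun a =>
    Finset.single_le_sum (f := fun a => |u a|) (fun _ _ => abs_nonneg _) (Finset.mem_univ a)
  linarith [h a, h b, le_abs_self (u a), neg_le_abs (u b)]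

lemma cornerVal_osc {u : Fin 3 → ℝ} {d : ℝ} (h : ∀ a b, u a - u b ≤ d) (ω : ℕ → Fin 3) (n : ℕ) :
    ∀ a b, cornerVal u ω n a - cornerVal u ω n b ≤ d * (3 / 5) ^ n := by
  induction n with
  | zero => simpa [cornerVal] using h
  | succ n ih =>
    intro a b
    have := step_osc ih (ω n) a b
    rw [cornerVal, pow_succ]
    linarith

/-- Each step moves a corner value by at most the current oscillation, which decays like `(3/5)^n`.
The sequences are therefore Cauchy, and the limit is the same at all three corners. -/
lemma exists_tendsto_cornerVal (u : Fin 3 → ℝ) (ω : ℕ → Fin 3) :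
    ∃ t, ∀ a, Filter.Tendsto (fun n => cornerVal u ω n a) Filter.atTop (𝓝 t) := by
  obtain ⟨d, hd⟩ := exists_osc u
  have hosc := cornerVal_osc hd ω
  have hc : ∀ a, CauchySeq fun n => cornerVal u ω n a := by
    intro a
    refine cauchySeq_of_le_geometric (3 / 5) d (by norm_num) fun n => ?_
    rw [dist_comm, Real.dist_eq]
    exact abs_step_sub (hosc n) (ω n) a
  obtain ⟨t, ht⟩ := cauchySeq_tendsto_of_complete (hc 0)
  refine ⟨t, fun a => ?_⟩
  have hz : Filter.Tendsto (fun n => cornerVal u ω n a - cornerVal u ω n 0) Filter.atTop (𝓝 0) := by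
    refine squeeze_zero_norm (a := fun n => d * (3 / 5) ^ n) (fun n => ?_) ?_
    · rw [Real.norm_eq_abs, abs_le]
      constructor <;> linarith [hosc n a 0, hosc n 0 a]
    · simpa using (tendsto_pow_atTop_nhds_zero_of_lt_one (by norm_num : (0 : ℝ) ≤ 3 / 5)
        (by norm_num)).const_mul d
  simpa using hz.add ht

/-- The value at the point with address `ω` of the harmonic function with value `1` at the corner
`q i` and value `0` at the two other corners. -/
def lam (i : Fin 3) (ω : ℕ → Fin 3) : ℝ :=
  (exists_tendsto_cornerVal (Pi.single i 1) ω).choose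

lemma tendsto_lam (i : Fin 3) (ω : ℕ → Fin 3) (a : Fin 3) :
    Filter.Tendsto (fun n => cornerVal (Pi.single i 1) ω n a) Filter.atTop (𝓝 (lam i ω)) :=
  (exists_tendsto_cornerVal (Pi.single i 1) ω).choose_spec a

lemma cornerVal_eq_sum (u : Fin 3 → ℝ) (ω : ℕ → Fin 3) (n : ℕ) (a : Fin 3) :
    cornerVal u ω n a = ∑ i, u i * cornerVal (Pi.single i 1) ω n a := by
  induction n generalizing a with
  | zero => simp [cornerVal, Pi.single_apply]
  | succ n ih =>
    simp only [cornerVal, step]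
    split_ifs with h
    · rw [ih]
    · simp only [Fin.sum_univ_three, ih]
      ring

lemma tendsto_cornerVal (u : Fin 3 → ℝ) (ω : ℕ → Fin 3) (a : Fin 3) :
    Filter.Tendsto (fun n => cornerVal u ω n a) Filter.atTop (𝓝 (∑ i, u i * lam i ω)) := by
  simp_rw [cornerVal_eq_sum u ω]
  exact tendsto_finsetSum _ fun i _ => (tendsto_lam i ω a).const_mul _

/-- The rule is a weighted average. Nonnegativity here and the constants in `cornerVal_one` place
the vector of the `lam i ω` in the simplex. -/
lemma cornerVal_nonneg {u : Fin 3 → ℝ} (hu : ∀ a, 0 ≤ u a) (ω : ℕ → Fin 3) (n : ℕ) (a : Fin 3) :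
    0 ≤ cornerVal u ω n a := by
  induction n generalizing a with
  | zero => exact hu a
  | succ n ih =>
    simp only [cornerVal, step]
    split_ifs
    · exact ih _
    · have := Finset.sum_nonneg fun l (_ : l ∈ Finset.univ) => ih l
      have := ih (ω n)
      have := ih a
      positivity

lemma cornerVal_one (ω : ℕ → Fin 3) (n : ℕ) (a : Fin 3) : cornerVal 1 ω n a = 1 := by
  induction n generalizing a with
  | zero => rfl
  | succ n ih =>
    simp only [cornerVal, step, ih]
    norm_num

lemma lam_nonneg (i : Fin 3) (ω : ℕ → Fin 3) : 0 ≤ lam i ω := by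
  refine ge_of_tendsto' (tendsto_lam i ω 0) fun n => cornerVal_nonneg (fun a => ?_) ω n 0
  by_cases h : a = i
  · subst h
    simp
  · simp [h]

lemma sum_lam (ω : ℕ → Fin 3) : ∑ i, lam i ω = 1 := by
  have h := tendsto_cornerVal 1 ω 0
  simp only [cornerVal_one, Pi.one_apply, one_mul] at h
  exact tendsto_nhds_unique h tendsto_const_nhds

lemma lam_le_one (i : Fin 3) (ω : ℕ → Fin 3) : lam i ω ≤ 1 := by
  rw [← sum_lam ω]
  exact Finset.single_le_sum (fun a _ => lam_nonneg a ω) (Finset.mem_univ i)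

lemma cornerVal_comp_perm (σ : Equiv.Perm (Fin 3)) (u : Fin 3 → ℝ) (ω : ℕ → Fin 3) (n : ℕ)
    (a : Fin 3) : cornerVal u (σ ∘ ω) n (σ a) = cornerVal (u ∘ σ) ω n a := by
  induction n generalizing a with
  | zero => rfl
  | succ n ih =>
    simp only [cornerVal, step, Function.comp_apply, EmbeddingLike.apply_eq_iff_eq, ih]
    rw [← Equiv.sum_comp σ fun l => cornerVal u (σ ∘ ω) n l]
    simp only [ih]

lemma lam_comp_perm (σ : Equiv.Perm (Fin 3)) (i : Fin 3) (ω : ℕ → Fin 3) :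
    lam (σ i) (σ ∘ ω) = lam i ω := by
  have h := tendsto_lam (σ i) (σ ∘ ω) (σ 0)
  simp only [cornerVal_comp_perm] at h
  have e : (Pi.single (σ i) (1 : ℝ) : Fin 3 → ℝ) ∘ σ = Pi.single i 1 := by
    ext a
    simp [Pi.single_apply]
  rw [e] at h
  exact tendsto_nhds_unique h (tendsto_lam i ω 0)

lemma measurable_cornerVal (u : Fin 3 → ℝ) (n : ℕ) (a : Fin 3) :
    Measurable fun ω => cornerVal u ω n a := by
  induction n generalizing a with
  | zero => exact measurable_const
  | succ n ih =>
    have h : (fun ω => cornerVal u ω (n + 1) a) =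
        fun ω => ∑ i, if ω n = i then step i (cornerVal u ω n) a else 0 := by
      ext ω
      simp [cornerVal]
    rw [h]
    refine Finset.measurable_sum _ fun i _ => Measurable.ite ?_ ?_ measurable_const
    · exact measurableSet_eq_fun (measurable_pi_apply n) measurable_const
    · unfold step
      split_ifs
      · exact ih i
      · exact (((ih i).add (ih a)).add (Finset.measurable_sum _ fun l _ => ih l)).div_const 5

lemma measurable_lam (i : Fin 3) : Measurable (lam i) :=
  measurable_of_tendsto_metrizable (fun n => measurable_cornerVal (Pi.single i 1) n 0)
    (tendsto_pi_nhds.2 fun ω => tendsto_lam i ω 0)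

lemma integrable_lam (i : Fin 3) : Integrable (lam i) seqMeasure :=
  Integrable.of_bound (measurable_lam i).aestronglyMeasurable 1
    (Filter.Eventually.of_forall fun ω => by
      rw [Real.norm_of_nonneg (lam_nonneg i ω)]
      exact lam_le_one i ω)

/-! ### Harmonic functions along an address -/

/-- The word of the first `n` letters of a sequence. -/
def truncWord (ω : ℕ → Fin 3) : ℕ → List (Fin 3)
  | 0 => []
  | n + 1 => truncWord ω n ++ [ω n]

lemma length_truncWord (ω : ℕ → Fin 3) (n : ℕ) : (truncWord ω n).length = n := by
  induction n with
  | zero => rfl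
  | succ n ih => simp [truncWord, ih]

lemma Fw_truncWord_address (q : Fin 3 → Plane) (ω : ℕ → Fin 3) (n : ℕ) :
    Fw q (truncWord ω n) (address q fun l => ω (l + n)) = address q ω := by
  induction n with
  | zero => rfl
  | succ n ih =>
    rw [truncWord, Fw_snoc, F_address, ← ih]
    congr 2
    ext l
    cases l with
    | zero => simp [consSeq]
    | succ l => simp [consSeq, add_right_comm, add_assoc]

lemma exists_dist_le (q : Fin 3 → Plane) :
    ∃ R, 0 ≤ R ∧ ∀ y ∈ gasket q, ∀ z ∈ gasket q, dist y z ≤ R :=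
  ⟨Metric.diam (gasket q), Metric.diam_nonneg, fun _ hy _ hz =>
    Metric.dist_le_diam_of_mem (isCompact_gasket q).isBounded hy hz⟩

lemma tendsto_corner_address (q : Fin 3 → Plane) (ω : ℕ → Fin 3) (a : Fin 3) :
    Filter.Tendsto (fun n => Fw q (truncWord ω n) (q a)) Filter.atTop (𝓝 (address q ω)) := by
  obtain ⟨R, hR, hd⟩ := exists_dist_le q
  rw [tendsto_iff_dist_tendsto_zero]
  refine squeeze_zero (fun _ => dist_nonneg) (g := fun n => (1 / 2 : ℝ) ^ n * R) (fun n => ?_) ?_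
  · rw [← Fw_truncWord_address q ω n, dist_Fw, length_truncWord]
    exact mul_le_mul_of_nonneg_left (hd _ (corner_mem_gasket q a) _ ⟨_, rfl⟩) (by positivity)
  · simpa using (tendsto_pow_atTop_nhds_zero_of_lt_one (by norm_num : (0 : ℝ) ≤ 1 / 2)
      (by norm_num)).mul_const R

/-- The values of `f` at the corners of the cells obey the harmonic extension rule. -/
def ObeysRule (q : Fin 3 → Plane) (f : Plane → ℝ) : Prop :=
  ∀ (w : List (Fin 3)) (i a : Fin 3),
    f (Fw q (w ++ [i]) (q a)) = step i (fun l => f (Fw q w (q l))) a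

/-- Lets the integral formula, applied to the constant 1, also yield the measure of `B(c₀, c₁, c₂)`.
-/
lemma obeysRule_one (q : Fin 3 → Plane) : ObeysRule q fun _ => 1 := by
  intro w i a
  simp only [step]
  norm_num

/-- The mean value equations at the three junction points inside the cell form a linear system for
the three new values; its solution is the 2/5, 2/5, 1/5 rule. -/
lemma IsEquilateral.obeysRule (hq : IsEquilateral q s) {f : Plane → ℝ} (hf : IsHarmonic q f) :
    ObeysRule q f := by
  intro w
  have hself : ∀ a, Fw q (w ++ [a]) (q a) = Fw q w (q a) := fun a => by
    rw [Fw_snoc, F_corner_self]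
  have hcomm : ∀ a b, Fw q (w ++ [a]) (q b) = Fw q (w ++ [b]) (q a) := fun a b => by
    rw [Fw_snoc, Fw_snoc, F_corner_comm]
  -- A corner of the gasket would need a constant word ending in `b`, but the last letter is `a`.
  have hbd : ∀ a b, a ≠ b → Fw q (w ++ [a]) (q b) ∉ boundary q := by
    rintro a b hab ⟨l, hl⟩
    obtain ⟨h1, h2⟩ := hq.eq_replicate_of_Fw_eq_corner (corner_mem_gasket q b) hl.symm
    have ha : a = l := by
      have : a ∈ List.replicate (w ++ [a]).length l := by
        rw [← h1]
        simp
      exact List.eq_of_mem_replicate this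
    exact hab (ha.trans (hq.corner_injective h2).symm)
  have hne : ∀ a b : Fin 3, a ≠ b → w ++ [a] ≠ w ++ [b] := fun a b hab h => hab (by simpa using h)
  have e01 := hq.harmonic_corner (w := w ++ [0]) (v := w ++ [1]) (by simp)
    (hne 1 0 (by decide)) (hcomm 1 0) hf (hbd 0 1 (by decide))
  have e02 := hq.harmonic_corner (w := w ++ [0]) (v := w ++ [2]) (by simp)
    (hne 2 0 (by decide)) (hcomm 2 0) hf (hbd 0 2 (by decide))
  have e12 := hq.harmonic_corner (w := w ++ [1]) (v := w ++ [2]) (by simp)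
    (hne 2 1 (by decide)) (hcomm 2 1) hf (hbd 1 2 (by decide))
  simp only [Fin.isValue, show (0 : Fin 3) + 1 = 1 from rfl, show (0 : Fin 3) + 2 = 2 from rfl,
    show (1 : Fin 3) + 1 = 2 from rfl, show (1 : Fin 3) + 2 = 0 from rfl,
    show (2 : Fin 3) + 1 = 0 from rfl, show (2 : Fin 3) + 2 = 1 from rfl, hself,
    hcomm 1 0, hcomm 2 0, hcomm 2 1] at e01 e02 e12
  intro i a
  fin_cases i <;> fin_cases a <;>
    simp [step, Fin.sum_univ_three, hself, hcomm 1 0, hcomm 2 0, hcomm 2 1] <;> linarith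

/-- A function that obeys the harmonic extension rule is determined on a cell by its values at the
corners. -/
lemma ObeysRule.apply_address {f : Plane → ℝ} (hf : ObeysRule q f)
    (hc : ContinuousOn f (gasket q)) (v : List (Fin 3)) (ω : ℕ → Fin 3) :
    f (Fw q v (address q ω)) = ∑ i, f (Fw q v (q i)) * lam i ω := by
  have h : ∀ n a, cornerVal (fun l => f (Fw q v (q l))) ω n a =
      f (Fw q v (Fw q (truncWord ω n) (q a))) := by
    intro n
    induction n with
    | zero => exact fun a => rfl
    | succ n ih =>
      intro a
      rw [cornerVal, truncWord, ← Fw_append, ← List.append_assoc, hf]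
      congr 1
      ext l
      rw [ih, Fw_append]
  have ht := tendsto_cornerVal (fun l => f (Fw q v (q l))) ω 0
  simp only [h] at ht
  refine tendsto_nhds_unique ?_ ht
  have hcv : ContinuousOn (fun y => f (Fw q v y)) (gasket q) :=
    hc.comp (continuous_Fw q v).continuousOn fun y hy => Fw_mem_gasket v hy
  refine (hcv (address q ω) ⟨ω, rfl⟩).tendsto.comp ?_
  exact tendsto_nhdsWithin_iff.2 ⟨tendsto_corner_address q ω 0,
    Filter.Eventually.of_forall fun n => Fw_mem_gasket _ (corner_mem_gasket q 0)⟩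

/-! ### Integrals over the parts that are cut off -/

/-- The addresses of the points cut off from the gasket at the corner `q j` by the line at distance
`c` times the height. -/
def cutSeq (j : Fin 3) (c : ℝ) : Set (ℕ → Fin 3) := {ω | 1 - c ≤ bary j ω}

/-- The measure of the part cut off at height `c`. -/
def massFn (c : ℝ) : ℝ := seqMeasure.real (cutSeq 0 c)

/-- The integral, over the part cut off at one corner at height `c`, of the harmonic function with
value `1` at another corner and value `0` at the two remaining ones. -/
def sideFn (c : ℝ) : ℝ := ∫ ω in cutSeq 0 c, lam 1 ω ∂seqMeasure

lemma measurableSet_cutSeq (j : Fin 3) (c : ℝ) : MeasurableSet (cutSeq j c) :=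
  measurableSet_le measurable_const (measurable_bary j)

lemma cutSeq_mono (j : Fin 3) {c c' : ℝ} (h : c ≤ c') : cutSeq j c ⊆ cutSeq j c' := by
  intro ω hω
  simp only [cutSeq, Set.mem_ofPred_eq] at hω ⊢
  linarith

lemma cutSeq_one (j : Fin 3) : cutSeq j 1 = Set.univ := by
  ext ω
  simp [cutSeq, bary_nonneg]

lemma measure_cutSeq_zero (j : Fin 3) : seqMeasure (cutSeq j 0) = 0 := by
  refine measure_mono_null (fun ω hω => ?_) (measure_bary_eq j 1)
  simp only [cutSeq, Set.mem_ofPred_eq] at hω ⊢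
  linarith [bary_le_one j ω]

lemma measurable_comp_perm (σ : Equiv.Perm (Fin 3)) :
    Measurable fun ω : ℕ → Fin 3 => σ ∘ ω :=
  measurable_pi_iff.2 fun n => (Measurable.of_discrete (f := σ)).comp (measurable_pi_apply n)

lemma preimage_cutSeq (σ : Equiv.Perm (Fin 3)) (j : Fin 3) (c : ℝ) :
    (fun ω : ℕ → Fin 3 => σ ∘ ω) ⁻¹' cutSeq (σ j) c = cutSeq j c := by
  ext ω
  simp [cutSeq, bary_comp_perm]

lemma setIntegral_lam_perm (σ : Equiv.Perm (Fin 3)) (i j : Fin 3) (c : ℝ) :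
    ∫ ω in cutSeq (σ j) c, lam (σ i) ω ∂seqMeasure = ∫ ω in cutSeq j c, lam i ω ∂seqMeasure := by
  conv_lhs => rw [← seqMeasure_map_perm σ]
  rw [setIntegral_map (measurableSet_cutSeq _ c) (measurable_lam _).aestronglyMeasurable
    (measurable_comp_perm σ).aemeasurable, preimage_cutSeq]
  simp only [lam_comp_perm]

/-- A permutation of the digits carries the pair `0, 1` to `j, i`, so one function covers all six
cases. -/
lemma setIntegral_lam_side {i j : Fin 3} (h : i ≠ j) (c : ℝ) :
    ∫ ω in cutSeq j c, lam i ω ∂seqMeasure = sideFn c := by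
  obtain ⟨σ, rfl, rfl⟩ : ∃ σ : Equiv.Perm (Fin 3), σ 0 = j ∧ σ 1 = i := by
    revert i j
    decide
  exact setIntegral_lam_perm σ 1 0 c

lemma measureReal_cutSeq (j : Fin 3) (c : ℝ) : seqMeasure.real (cutSeq j c) = massFn c := by
  have h := preimage_cutSeq (Equiv.swap 0 j) 0 c
  rw [Equiv.swap_apply_left] at h
  rw [massFn, ← h, ← map_measureReal_apply (measurable_comp_perm _) (measurableSet_cutSeq j c),
    seqMeasure_map_perm]

lemma sum_setIntegral_lam (j : Fin 3) (c : ℝ) :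
    ∑ i, ∫ ω in cutSeq j c, lam i ω ∂seqMeasure = massFn c := by
  rw [← integral_finsetSum _ fun i _ => (integrable_lam i).integrableOn]
  simp only [sum_lam]
  simp [measureReal_cutSeq]

lemma setIntegral_lam_self (j : Fin 3) (c : ℝ) :
    ∫ ω in cutSeq j c, lam j ω ∂seqMeasure = massFn c - 2 * sideFn c := by
  have h := sum_setIntegral_lam j c
  rw [fin_three_sum _ j, setIntegral_lam_side (fin_three_add_one_ne j),
    setIntegral_lam_side (fin_three_add_two_ne j)] at h
  linarith

/-- The far corners have the common weight `sideFn c`, and the weights add up to `massFn c`.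
Grouping by the second difference prepares the use of the mean value equation. -/
lemma setIntegral_sum_lam (u : Fin 3 → ℝ) (j : Fin 3) (c : ℝ) :
    ∫ ω in cutSeq j c, ∑ i, u i * lam i ω ∂seqMeasure =
      massFn c * u j + sideFn c * (u (j + 1) + u (j + 2) - 2 * u j) := by
  rw [integral_finsetSum _ fun i _ => ((integrable_lam i).const_mul (u i)).integrableOn]
  simp only [integral_const_mul]
  rw [fin_three_sum _ j, setIntegral_lam_side (fin_three_add_one_ne j),
    setIntegral_lam_side (fin_three_add_two_ne j), setIntegral_lam_self]
  ring

lemma massFn_zero : massFn 0 = 0 := by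
  rw [massFn, measureReal_def, measure_cutSeq_zero, ENNReal.toReal_zero]

lemma massFn_one : massFn 1 = 1 := by
  rw [massFn, cutSeq_one]
  simp

lemma sideFn_zero : sideFn 0 = 0 := by
  rw [sideFn, Measure.restrict_eq_zero.2 (measure_cutSeq_zero 0), integral_zero_measure]

lemma sideFn_one : sideFn 1 = 1 / 3 := by
  have h := setIntegral_lam_self 0 1
  -- The whole space is also the full cut at corner 1, for which `lam 0` belongs to a far corner; so
  -- all three integrals agree.
  rw [cutSeq_one, ← cutSeq_one 1, setIntegral_lam_side (by decide), massFn_one] at h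
  linarith

lemma massFn_mono : Monotone massFn := fun _ _ h => measureReal_mono (cutSeq_mono 0 h)

lemma sideFn_mono : Monotone sideFn := fun _ _ h =>
  setIntegral_mono_set (integrable_lam 1).integrableOn
    (Filter.Eventually.of_forall fun ω => lam_nonneg 1 ω) (cutSeq_mono 0 h).eventuallyLE

/-- Dominated convergence: for fixed `ω` the indicator is locally constant in the height except
where `bary j ω = 1 - c`, which is a null event. -/
lemma continuous_setIntegral_cutSeq {g : (ℕ → Fin 3) → ℝ} (hg : Integrable g seqMeasure)
    (j : Fin 3) : Continuous fun c => ∫ ω in cutSeq j c, g ω ∂seqMeasure := by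
  simp_rw [← integral_indicator (measurableSet_cutSeq j _)]
  refine continuous_iff_continuousAt.2 fun c => continuousAt_of_dominated (bound := fun ω => ‖g ω‖)
    ?_ ?_ hg.norm ?_
  · exact Filter.Eventually.of_forall fun c =>
      (hg.indicator (measurableSet_cutSeq j c)).aestronglyMeasurable
  · exact Filter.Eventually.of_forall fun c => Filter.Eventually.of_forall fun ω =>
      norm_indicator_le_norm_self _ _
  · have h : ∀ᵐ ω ∂seqMeasure, bary j ω ≠ 1 - c := by
      rw [ae_iff]
      simpa using measure_bary_eq j (1 - c)
    filter_upwards [h] with ω hω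
    rcases lt_or_gt_of_ne hω with hlt | hgt
    · refine (continuousAt_const (y := (0 : ℝ))).congr ?_
      filter_upwards [eventually_lt_nhds (show c < 1 - bary j ω by linarith)] with c' hc'
      rw [Set.indicator_of_notMem]
      simp only [cutSeq, Set.mem_ofPred_eq]
      linarith
    · refine (continuousAt_const (y := g ω)).congr ?_
      filter_upwards [eventually_gt_nhds (show 1 - bary j ω < c by linarith)] with c' hc'
      rw [Set.indicator_of_mem]
      simp only [cutSeq, Set.mem_ofPred_eq]
      linarith

lemma continuous_sideFn : Continuous sideFn := continuous_setIntegral_cutSeq (integrable_lam 1) 0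

lemma continuous_massFn : Continuous massFn := by
  have h := continuous_setIntegral_cutSeq (integrable_const (1 : ℝ)) 0
  simp only [integral_const, measureReal_restrict_apply_univ, smul_eq_mul, mul_one] at h
  exact h

/-! ### Solving for the heights -/

/-- A solution of the equations for two heights, where the third one is zero. -/
lemma exists_two_heights {m b : ℝ → ℝ} (hm : Monotone m) (hb : Monotone b) (hmc : Continuous m)
    (hbc : Continuous b) (hm0 : m 0 = 0) (hb0 : b 0 = 0) (hm1 : m 1 = 1) (hb1 : b 1 = 1 / 3)
    {d₀ d₁ : ℝ} (hd₀ : 0 ≤ d₀) (hd₁ : 0 ≤ d₁) (hd : d₀ + d₁ ≤ 1) :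
    ∃ c₀ ∈ Set.Icc (0 : ℝ) 1, ∃ c₁ ∈ Set.Icc (0 : ℝ) 1,
      m c₀ + 3 * b c₀ = (1 + m c₀ + m c₁) * d₀ ∧ m c₁ + 3 * b c₁ = (1 + m c₀ + m c₁) * d₁ := by
  -- A right inverse of `m + 3b`, whose range on `[0, 1]` is `[0, 2]`; clamping the argument makes
  -- it defined everywhere.
  have hsurj : ∀ t : ℝ, ∃ c ∈ Set.Icc (0 : ℝ) 1, m c + 3 * b c = min (max t 0) 2 := by
    intro t
    have h := intermediate_value_Icc (zero_le_one (α := ℝ))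
      (hmc.add (hbc.const_mul 3)).continuousOn
    obtain ⟨c, hc, e⟩ := h (show min (max t 0) 2 ∈ Set.Icc (m 0 + 3 * b 0) (m 1 + 3 * b 1) by
      rw [hm0, hb0, hm1, hb1]
      norm_num)
    exact ⟨c, hc, e⟩
  choose C hC hCf using hsurj
  -- As `b` is also monotone, `m` is a 1-Lipschitz function of `m + 3b`. Thus `m ∘ C` is continuous
  -- although the choice `C` need not be.
  have hlip : ∀ c c', |m c - m c'| ≤ |(m c + 3 * b c) - (m c' + 3 * b c')| := by
    intro c c'
    rcases le_total c c' with h | h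
    · have h1 := hm h
      have h2 := hb h
      rw [abs_of_nonpos (by linarith), abs_of_nonpos (by linarith)]
      linarith
    · have h1 := hm h
      have h2 := hb h
      rw [abs_of_nonneg (by linarith), abs_of_nonneg (by linarith)]
      linarith
  have hψ : Continuous fun t => m (C t) := by
    refine (LipschitzWith.of_dist_le_mul (K := 1) fun t t' => ?_).continuous
    rw [Real.dist_eq, Real.dist_eq, NNReal.coe_one, one_mul]
    refine (hlip (C t) (C t')).trans ?_
    rw [hCf, hCf]
    exact (abs_min_sub_min_le_max _ _ _ _).trans (by
      simpa using abs_max_sub_max_le_max t 0 t' 0)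
  have hm_le : ∀ t, m (C t) ≤ 1 := fun t => hm1 ▸ hm (hC t).2
  have hm_nonneg : ∀ t, 0 ≤ m (C t) := fun t => hm0 ▸ hm (hC t).1
  have hb_nonneg : ∀ t, 0 ≤ b (C t) := fun t => hb0 ▸ hb (hC t).1
  -- `θ` stands for the total mass `1 + m c₀ + m c₁`, which lies in `[1, 3]`; a zero of this
  -- function makes it consistent.
  have hcont : Continuous fun θ : ℝ => m (C (θ * d₀)) + m (C (θ * d₁)) - (θ - 1) :=
    ((hψ.comp (continuous_mul_const d₀)).add (hψ.comp (continuous_mul_const d₁))).sub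
      (continuous_id.sub continuous_const)
  obtain ⟨θ, hθ, e⟩ := intermediate_value_Icc' (show (1 : ℝ) ≤ 3 by norm_num) hcont.continuousOn
    (show (0 : ℝ) ∈ Set.Icc _ _ from
      ⟨by linarith [hm_le (3 * d₀), hm_le (3 * d₁)],
        by linarith [hm_nonneg (1 * d₀), hm_nonneg (1 * d₁)]⟩)
  have hθ1 : 0 ≤ θ := by linarith [hθ.1]
  have hsum : θ * d₀ + θ * d₁ ≤ θ := by nlinarith
  -- The clamp at 2 is inactive at the root: `x > 2` would give `θ - 1 ≤ 1 + y`, since `m (C y) ≤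
  -- y`, and hence `θ < x + y`.
  have key : ∀ x y : ℝ, 0 ≤ y → x + y ≤ θ → m (C x) + m (C y) = θ - 1 → x ≤ 2 := by
    intro x y hy hxy hxyθ
    by_contra! hx
    have h1 := hCf y
    have h2 : min (max y 0) 2 ≤ y := (min_le_left _ _).trans (max_le le_rfl hy)
    linarith [hm_le x, hb_nonneg y]
  have hθd₀ : 0 ≤ θ * d₀ := mul_nonneg hθ1 hd₀
  have hθd₁ : 0 ≤ θ * d₁ := mul_nonneg hθ1 hd₁
  have e' : m (C (θ * d₀)) + m (C (θ * d₁)) = θ - 1 := by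
    simp only at e
    linarith
  have h0 := key _ _ hθd₁ hsum e'
  have h1 := key (θ * d₁) _ hθd₀ (by linarith) (by linarith)
  have hθ' : 1 + m (C (θ * d₀)) + m (C (θ * d₁)) = θ := by linarith
  refine ⟨C (θ * d₀), hC _, C (θ * d₁), hC _, ?_, ?_⟩
  · rw [hθ', hCf, max_eq_left hθd₀, min_eq_left h0]
  · rw [hθ', hCf, max_eq_left hθd₁, min_eq_left h1]

/-- Every point of the standard simplex is the vector of coefficients of some mean value. -/
lemma exists_heights {m b : ℝ → ℝ} (hm : Monotone m) (hb : Monotone b) (hmc : Continuous m)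
    (hbc : Continuous b) (hm0 : m 0 = 0) (hb0 : b 0 = 0) (hm1 : m 1 = 1) (hb1 : b 1 = 1 / 3)
    {a : Fin 3 → ℝ} (ha : ∀ i, 0 ≤ a i) (hsum : ∑ i, a i = 1) :
    ∃ c : Fin 3 → ℝ, (∀ i, c i ∈ Set.Icc (0 : ℝ) 1) ∧
      ∀ i, 1 / 3 + m (c i) + 3 * b (c i) - ∑ l, b (c l) = (1 + ∑ l, m (c l)) * a i := by
  obtain ⟨j, hj⟩ := Finite.exists_min a
  rw [fin_three_sum a j] at hsum
  -- With height 0 at the minimal index `j`, these are the differences to equation `j`. Since the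
  -- left sides sum to the total mass, the two differences imply all three equations.
  obtain ⟨c₀, hc₀, c₁, hc₁, e₀, e₁⟩ := exists_two_heights hm hb hmc hbc hm0 hb0 hm1 hb1
    (sub_nonneg.2 (hj (j + 1))) (sub_nonneg.2 (hj (j + 2))) (by linarith [ha j])
  have n1 := fin_three_add_one_ne j
  have n2 := fin_three_add_two_ne j
  have n3 := fin_three_add_two_ne_add_one j
  refine ⟨fun i => if i = j then 0 else if i = j + 1 then c₀ else c₁, fun i => ?_, fun i => ?_⟩
  · dsimp only
    split_ifs
    · simp
    · exact hc₀
    · exact hc₁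
  · rw [fin_three_sum _ j, fin_three_sum _ j]
    simp only [if_true, if_neg n1, if_neg n2, if_neg n3, hm0, hb0]
    have h2 : a (j + 2) = 1 - a j - a (j + 1) := by linarith
    rw [h2] at e₁
    rcases fin_three_cases i j with rfl | rfl | rfl
    · simp only [if_true, hm0, hb0]
      linear_combination (-1 / 3 : ℝ) * e₀ - 1 / 3 * e₁
    · simp only [if_true, if_neg n1]
      linear_combination (2 / 3 : ℝ) * e₀ - 1 / 3 * e₁
    · simp only [if_neg n2, if_neg n3, h2]
      linear_combination (-1 / 3 : ℝ) * e₀ + 2 / 3 * e₁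

lemma exists_heights_of_simplex {a : Fin 3 → ℝ} (ha : ∀ i, 0 ≤ a i) (hsum : ∑ i, a i = 1) :
    ∃ c : Fin 3 → ℝ, (∀ i, c i ∈ Set.Icc (0 : ℝ) 1) ∧
      ∀ i, 1 / 3 + massFn (c i) + 3 * sideFn (c i) - ∑ l, sideFn (c l) =
        (1 + ∑ l, massFn (c l)) * a i :=
  exists_heights massFn_mono sideFn_mono continuous_massFn continuous_sideFn massFn_zero
    sideFn_zero massFn_one sideFn_one ha hsum

/-! ### Mean values over the sets `B(c₀, c₁, c₂)` -/

/-- The part of the gasket cut off at the corner `q j` by the line at distance `c` times the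
height. -/
def cutGasket (q : Fin 3 → Plane) (j : Fin 3) (c : ℝ) : Set Plane :=
  {y ∈ gasket q | 1 - c ≤ coord q j y}

lemma measurableSet_cutGasket (q : Fin 3 → Plane) (j : Fin 3) (c : ℝ) :
    MeasurableSet (cutGasket q j c) :=
  (measurableSet_gasket q).inter
    (measurableSet_le measurable_const (continuous_coord q j).measurable)

lemma cutGasket_subset (q : Fin 3 → Plane) (j : Fin 3) (c : ℝ) : cutGasket q j c ⊆ gasket q :=
  fun _ hy => hy.1

namespace IsEquilateral

lemma cutGasket_one (hq : IsEquilateral q s) (j : Fin 3) : cutGasket q j 1 = gasket q := by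
  refine (cutGasket_subset q j 1).antisymm fun y hy => ⟨hy, ?_⟩
  rw [sub_self]
  exact hq.coord_nonneg j hy

lemma cellSize_eq (hq : IsEquilateral q s) (w : List (Fin 3)) :
    cellSize q w = (1 / 2 : ℝ) ^ w.length * (√3 / 2 * s) := by
  rw [cellSize, ← Fw_midpoint, dist_Fw, dist_comm, dist_eq_norm]
  exact congrArg _ (hq.norm_axis 0)

lemma cellSize_pos (hq : IsEquilateral q s) (w : List (Fin 3)) : 0 < cellSize q w := by
  have := hq.pos
  rw [hq.cellSize_eq]
  positivity

/-- Distance along the axis and cell size both scale by `2^{-k}`, so every cut is the image of one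
cut of the whole gasket. -/
lemma cutOff_eq (hq : IsEquilateral q s) {w v : List (Fin 3)} (hl : v.length = w.length)
    (j : Fin 3) (c : ℝ) :
    cutOff q v j (c * cellSize q w) = Fw q v '' cutGasket q j c := by
  have hs := hq.pos
  have hρ : 0 < √3 / 2 * s := by positivity
  have hk : (0 : ℝ) < (1 / 2) ^ w.length := by positivity
  have key : ∀ z, inner ℝ (Fw q v z - Fw q v (q j)) (Fw q v (oppMid q j) - Fw q v (q j)) /
      ‖Fw q v (oppMid q j) - Fw q v (q j)‖ ≤ c * cellSize q w ↔ 1 - c ≤ coord q j z := by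
    intro z
    rw [hq.cellSize_eq, Fw_sub, Fw_sub, norm_smul, Real.norm_of_nonneg (by positivity), hl,
      inner_smul_left, inner_smul_right, coord, hq.norm_axis, div_le_iff₀ (by positivity),
      sub_le_sub_iff_left, div_le_iff₀ (by positivity)]
    simp only [conj_trivial]
    have e : c * ((1 / 2 : ℝ) ^ w.length * (√3 / 2 * s)) *
        ((1 / 2 : ℝ) ^ w.length * (√3 / 2 * s)) =
        (1 / 2 : ℝ) ^ w.length * ((1 / 2 : ℝ) ^ w.length * (c * (√3 / 2 * s) ^ 2)) := by ring
    rw [e, mul_le_mul_iff_right₀ hk, mul_le_mul_iff_right₀ hk]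
  unfold cutOff
  simp only [← Fw_midpoint]
  ext y
  constructor
  · rintro ⟨⟨z, hz, rfl⟩, h⟩
    exact ⟨z, ⟨hz, (key z).1 h⟩, rfl⟩
  · rintro ⟨z, ⟨hz, h⟩, rfl⟩
    exact ⟨⟨z, hz, rfl⟩, (key z).2 h⟩

lemma setIntegral_cut (hq : IsEquilateral q s) {f : Plane → ℝ} (hf : ObeysRule q f)
    (hc : ContinuousOn f (gasket q)) (v : List (Fin 3)) (j : Fin 3) (c : ℝ) :
    ∫ y in Fw q v '' cutGasket q j c, f y ∂(gasketMeasure q) =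
      3⁻¹ ^ v.length * (massFn c * f (Fw q v (q j)) + sideFn c *
        (f (Fw q v (q (j + 1))) + f (Fw q v (q (j + 2))) - 2 * f (Fw q v (q j)))) := by
  have hcv : ContinuousOn (fun y => f (Fw q v y)) (gasket q) :=
    hc.comp (continuous_Fw q v).continuousOn fun y hy => Fw_mem_gasket v hy
  have hpre : address q ⁻¹' cutGasket q j c = cutSeq j c := by
    ext ω
    have : address q ω ∈ gasket q := ⟨ω, rfl⟩
    simp [cutGasket, cutSeq, hq.coord_address, this]
  rw [hq.setIntegral_image v (cutGasket_subset q j c) (measurableSet_cutGasket q j c)]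
  have h : ∫ y in cutGasket q j c, f (Fw q v y) ∂(gasketMeasure q) =
      ∫ ω in address q ⁻¹' cutGasket q j c, f (Fw q v (address q ω)) ∂seqMeasure :=
    setIntegral_map (measurableSet_cutGasket q j c)
      (aestronglyMeasurable_of_continuousOn hcv) (measurable_address q).aemeasurable
  rw [h, hpre, ← setIntegral_sum_lam fun l => f (Fw q v (q l))]
  simp only [hf.apply_address hc]

lemma setIntegral_cell (hq : IsEquilateral q s) {f : Plane → ℝ} (hf : ObeysRule q f)
    (hc : ContinuousOn f (gasket q)) (v : List (Fin 3)) :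
    ∫ y in cell q v, f y ∂(gasketMeasure q) =
      3⁻¹ ^ v.length * (1 / 3 * ∑ i, f (Fw q v (q i))) := by
  rw [cell, ← hq.cutGasket_one 0, hq.setIntegral_cut hf hc, massFn_one, sideFn_one,
    fin_three_sum _ 0]
  ring

lemma aedisjoint_cell (hq : IsEquilateral q s) {w v : List (Fin 3)} (hl : w.length = v.length)
    (hne : w ≠ v) : AEDisjoint (gasketMeasure q) (cell q w) (cell q v) :=
  hq.gasketMeasure_subsingleton (hq.cell_inter_subsingleton hl hne)

/-- The integral over `B(c₀, c₁, c₂)` of a function that is harmonic near `C_w`. -/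
lemma setIntegral_cutOffUnion (hq : IsEquilateral q s) {w : List (Fin 3)}
    {v : Fin 3 → List (Fin 3)} {j : Fin 3 → Fin 3} (hl : ∀ i, (v i).length = w.length)
    (hne : ∀ i, v i ≠ w) (hinj : Function.Injective v)
    (hp : ∀ i, Fw q (v i) (q (j i)) = Fw q w (q i)) (c : Fin 3 → ℝ)
    {f : Plane → ℝ} (hf : ObeysRule q f) (hc : ContinuousOn f (gasket q))
    (hcorner : ∀ i, 4 * f (Fw q w (q i)) = f (Fw q w (q (i + 1))) + f (Fw q w (q (i + 2))) +
      f (Fw q (v i) (q (j i + 1))) + f (Fw q (v i) (q (j i + 2)))) :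
    ∫ y in cell q w ∪ ⋃ i, cutOff q (v i) (j i) (c i * cellSize q w), f y ∂(gasketMeasure q) =
      3⁻¹ ^ w.length * ∑ i, (1 / 3 + massFn (c i) + 3 * sideFn (c i) - ∑ l, sideFn (c l)) *
        f (Fw q w (q i)) := by
  have hint := integrable_of_continuousOn hc
  simp only [hq.cutOff_eq (hl _)]
  have hm : ∀ i, MeasurableSet (Fw q (v i) '' cutGasket q (j i) (c i)) := fun i =>
    (measurableEmbedding_Fw q (v i)).measurableSet_image.2 (measurableSet_cutGasket q _ _)
  have hsub : ∀ i, Fw q (v i) '' cutGasket q (j i) (c i) ⊆ cell q (v i) := fun i =>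
    Set.image_mono (cutGasket_subset q _ _)
  have hd : Pairwise (Function.onFun (AEDisjoint (gasketMeasure q))
      fun i => Fw q (v i) '' cutGasket q (j i) (c i)) := fun i i' hii' =>
    (hq.aedisjoint_cell ((hl i).trans (hl i').symm) (hinj.ne hii')).mono (hsub i) (hsub i')
  have hd' : AEDisjoint (gasketMeasure q) (cell q w)
      (⋃ i, Fw q (v i) '' cutGasket q (j i) (c i)) :=
    AEDisjoint.iUnion_right_iff.2 fun i =>
      (hq.aedisjoint_cell (hl i).symm (hne i).symm).mono le_rfl (hsub i)
  rw [setIntegral_union₀ hd' (MeasurableSet.iUnion hm).nullMeasurableSet hint.integrableOn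
    hint.integrableOn, integral_iUnion_ae (fun i => (hm i).nullMeasurableSet) hd hint.integrableOn,
    tsum_fintype, hq.setIntegral_cell hf hc]
  simp only [hq.setIntegral_cut hf hc, hl, hp, ← Finset.mul_sum, ← mul_add]
  congr 1
  have h0 := hcorner 0
  have h1 := hcorner 1
  have h2 := hcorner 2
  simp only [Fin.isValue, show (0 : Fin 3) + 1 = 1 from rfl, show (0 : Fin 3) + 2 = 2 from rfl,
    show (1 : Fin 3) + 1 = 2 from rfl, show (1 : Fin 3) + 2 = 0 from rfl,
    show (2 : Fin 3) + 1 = 0 from rfl, show (2 : Fin 3) + 2 = 1 from rfl] at h0 h1 h2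
  simp only [Fin.sum_univ_three]
  -- Each mean value equation removes the two outer corners of one neighboring cell.
  linear_combination -sideFn (c 0) * h0 - sideFn (c 1) * h1 - sideFn (c 2) * h2

/-- The mean value over `B(c₀, c₁, c₂)` for suitable heights. -/
lemma setAverage_cutOffUnion (hq : IsEquilateral q s) {w : List (Fin 3)}
    {v : Fin 3 → List (Fin 3)} {j : Fin 3 → Fin 3} (hl : ∀ i, (v i).length = w.length)
    (hne : ∀ i, v i ≠ w) (hinj : Function.Injective v)
    (hp : ∀ i, Fw q (v i) (q (j i)) = Fw q w (q i)) (hb : Disjoint (cell q w) (boundary q))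
    {a c : Fin 3 → ℝ}
    (hac : ∀ i, 1 / 3 + massFn (c i) + 3 * sideFn (c i) - ∑ l, sideFn (c l) =
      (1 + ∑ l, massFn (c l)) * a i) {f : Plane → ℝ} (hf : IsHarmonic q f) :
    ⨍ y in cell q w ∪ ⋃ i, cutOff q (v i) (j i) (c i * cellSize q w), f y ∂(gasketMeasure q) =
      ∑ i, a i * f (Fw q w (q i)) := by
  have hM : 0 < 1 + ∑ l, massFn (c l) := by
    have : ∀ l, 0 ≤ massFn (c l) := fun l => measureReal_nonneg
    have := Finset.sum_nonneg fun l (_ : l ∈ Finset.univ) => this l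
    linarith
  have hint := hq.setIntegral_cutOffUnion hl hne hinj hp c (hq.obeysRule hf) hf.continuousOn
    fun i => hq.harmonic_corner (hl i) (hne i) (hp i) hf
      (Set.disjoint_left.1 hb ⟨q i, corner_mem_gasket q i, rfl⟩)
  have hmass := hq.setIntegral_cutOffUnion hl hne hinj hp c (obeysRule_one q) continuousOn_const
    fun i => by norm_num
  have hsum : ∑ i, (1 / 3 + massFn (c i) + 3 * sideFn (c i) - ∑ l, sideFn (c l)) * 1 =
      1 + ∑ l, massFn (c l) := by
    simp only [Fin.sum_univ_three]
    ring
  rw [hsum] at hmass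
  simp only [integral_const, measureReal_restrict_apply_univ, smul_eq_mul, mul_one] at hmass
  rw [setAverage_eq, hint, hmass, smul_eq_mul]
  simp only [hac, mul_assoc, ← Finset.mul_sum]
  have h3 : (3⁻¹ : ℝ) ^ w.length ≠ 0 := by positivity
  field_simp

end IsEquilateral

/-! ### Neighborhoods -/

/-- The cells of level `k` that contain `x` form a neighborhood of `x` in the gasket. -/
lemma star_mem_nhdsWithin (q : Fin 3 → Plane) (x : Plane) (k : ℕ) :
    {y | ∃ u : List (Fin 3), u.length = k ∧ x ∈ cell q u ∧ y ∈ cell q u} ∈ 𝓝[gasket q] x := by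
  have hfin : {u : List (Fin 3) | u.length = k ∧ x ∉ cell q u}.Finite :=
    (List.finite_length_eq (Fin 3) k).subset fun u hu => hu.1
  have hcl : IsClosed (⋃ u ∈ {u : List (Fin 3) | u.length = k ∧ x ∉ cell q u}, cell q u) :=
    hfin.isClosed_biUnion fun u _ => (isCompact_cell q u).isClosed
  have hx : x ∈ (⋃ u ∈ {u : List (Fin 3) | u.length = k ∧ x ∉ cell q u}, cell q u)ᶜ := by
    simp only [Set.mem_compl_iff, Set.mem_iUnion, not_exists]
    exact fun u hu hxu => hu.2 hxu
  filter_upwards [mem_nhdsWithin_of_mem_nhds (hcl.isOpen_compl.mem_nhds hx), self_mem_nhdsWithin]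
    with y hy hyg
  obtain ⟨u, hu, hyu⟩ := exists_mem_cell hyg k
  refine ⟨u, hu, ?_, hyu⟩
  by_contra hxu
  exact hy (Set.mem_biUnion (show u ∈ {u | _} from ⟨hu, hxu⟩) hyu)

namespace IsEquilateral

/-- Near `x` only the cells containing `x` matter: just `C_w` if `x` is not one of its corners, and
`C_w` with `C_i` if `x = p_i`, where a positive height suffices. -/
lemma cutOffUnion_mem_nhdsWithin (hq : IsEquilateral q s) {w : List (Fin 3)}
    {v : Fin 3 → List (Fin 3)} {j : Fin 3 → Fin 3} (hl : ∀ i, (v i).length = w.length)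
    (hne : ∀ i, v i ≠ w) (hp : ∀ i, Fw q (v i) (q (j i)) = Fw q w (q i)) {c : Fin 3 → ℝ}
    {x : Plane} (hx : x ∈ cell q w) (hpos : ∀ i, x = Fw q w (q i) → 0 < c i) :
    cell q w ∪ ⋃ i, cutOff q (v i) (j i) (c i * cellSize q w) ∈ 𝓝[gasket q] x := by
  by_cases hcor : ∃ i, x = Fw q w (q i)
  · obtain ⟨i, rfl⟩ := hcor
    have hnear : ∀ᶠ y in 𝓝 (Fw q w (q i)), inner ℝ (y - Fw q (v i) (q (j i)))
        (midpoint ℝ (Fw q (v i) (q (j i + 1))) (Fw q (v i) (q (j i + 2))) -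
          Fw q (v i) (q (j i))) /
        ‖midpoint ℝ (Fw q (v i) (q (j i + 1))) (Fw q (v i) (q (j i + 2))) -
          Fw q (v i) (q (j i))‖ < c i * cellSize q w := by
      refine ContinuousAt.eventually_lt (by fun_prop) continuousAt_const ?_
      rw [hp, sub_self, inner_zero_left, zero_div]
      exact mul_pos (hpos i rfl) (hq.cellSize_pos w)
    filter_upwards [star_mem_nhdsWithin q (Fw q w (q i)) w.length,
      mem_nhdsWithin_of_mem_nhds hnear] with y hy hyn
    obtain ⟨u, hu, hxu, hyu⟩ := hy
    rcases hq.eq_or_eq_of_mem_cells (hl i).symm (hu.trans (hl i).symm) (hne i).symm hx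
      ⟨q (j i), corner_mem_gasket q _, hp i⟩ hxu with rfl | rfl
    · exact Or.inl hyu
    · exact Or.inr (Set.mem_iUnion.2 ⟨i, hyu, le_of_lt hyn⟩)
  · filter_upwards [star_mem_nhdsWithin q x w.length] with y hy
    obtain ⟨u, hu, hxu, hyu⟩ := hy
    left
    by_cases huw : u = w
    · exact huw ▸ hyu
    · exfalso
      obtain ⟨z, hz, rfl⟩ := hx
      obtain ⟨t, ht, htz⟩ := hxu
      obtain ⟨i, rfl⟩ := (hq.exists_corner_of_Fw_eq hu huw ht hz htz).2
      exact hcor ⟨i, rfl⟩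

/-- The coefficients that express the value at a point of a cell of a harmonic function by the
values at the corners of the cell. -/
lemma exists_coefficients (hq : IsEquilateral q s) {w : List (Fin 3)} {x : Plane}
    (hx : x ∈ cell q w) :
    ∃ a : Fin 3 → ℝ, (∀ i, 0 ≤ a i) ∧ ∑ i, a i = 1 ∧ (∀ i, x = Fw q w (q i) → a i = 1) ∧
      ∀ f, IsHarmonic q f → f x = ∑ i, a i * f (Fw q w (q i)) := by
  -- At a corner the unit vector serves directly, without evaluating `lam` there.
  by_cases hcor : ∃ i, x = Fw q w (q i)
  · obtain ⟨i, rfl⟩ := hcor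
    refine ⟨Pi.single i 1, fun l => ?_, by simp, fun l hl => ?_, fun f _ => ?_⟩
    · by_cases h : l = i
      · subst h
        simp
      · simp [h]
    · rw [hq.corner_injective (Fw_injective q w hl), Pi.single_eq_same]
    · simp [Pi.single_apply]
  · obtain ⟨_, ⟨ω, rfl⟩, rfl⟩ := hx
    refine ⟨fun i => lam i ω, fun i => lam_nonneg i ω, sum_lam ω,
      fun i hi => absurd ⟨i, hi⟩ hcor, fun f hf => ?_⟩
    rw [(hq.obeysRule hf).apply_address hf.continuousOn]
    simp only [mul_comm]

/-- The heights are those that realize the coefficients of `x`. The factor 2 in the distance bound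
comes from passing through `p_i`, across one neighboring cell and `C_w`. -/
lemma exists_meanValueNhd (hq : IsEquilateral q s) {w : List (Fin 3)} {x : Plane}
    (hx : x ∈ cell q w) (hb : Disjoint (cell q w) (boundary q)) {R : ℝ}
    (hR : ∀ y ∈ gasket q, ∀ z ∈ gasket q, dist y z ≤ R) :
    ∃ B : Set Plane, IsMeanValueNhd q w.length x B ∧ B ∈ 𝓝[gasket q] x ∧ x ∈ B ∧
      ∀ y ∈ B, dist y x ≤ (1 / 2 : ℝ) ^ w.length * (2 * R) := by
  have hnb : ∀ i, ∃ v : List (Fin 3), ∃ j, v.length = w.length ∧ v ≠ w ∧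
      Fw q v (q j) = Fw q w (q i) := fun i =>
    (hq.exists_neighbor i w).resolve_left fun h => Set.disjoint_left.1 hb
      ⟨q i, corner_mem_gasket q i, h⟩ ⟨i, rfl⟩
  choose v j hl hne hp using hnb
  have hinter := fun i => hq.cell_inter_eq (hl i) (hne i) (hp i)
  -- The neighboring cells are distinct because they meet `C_w` in different corners.
  have hinj : Function.Injective v := fun i i' h => by
    have e := (hinter i).symm.trans ((congrArg (fun u => cell q u ∩ cell q w) h).trans (hinter i'))
    exact hq.corner_injective (Fw_injective q w (Set.singleton_injective e))
  obtain ⟨a, ha, hsum, ha1, hval⟩ := hq.exists_coefficients hx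
  obtain ⟨c, hc, hac⟩ := exists_heights_of_simplex ha hsum
  have hpos : ∀ i, x = Fw q w (q i) → 0 < c i := by
    intro i hi
    -- Height 0 at the corner `x` would give `1/3 - ∑ b(c_l) = 1 + ∑ m(c_l)`, impossible for
    -- nonnegative `b` and `m`.
    refine lt_of_le_of_ne (hc i).1 fun h0 => ?_
    have h := hac i
    rw [ha1 i hi, ← h0, massFn_zero, sideFn_zero] at h
    have hm : 0 ≤ ∑ l, massFn (c l) := Finset.sum_nonneg fun l _ => measureReal_nonneg
    have hs : 0 ≤ ∑ l, sideFn (c l) := Finset.sum_nonneg fun l _ =>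
      sideFn_zero ▸ sideFn_mono (hc l).1
    linarith
  refine ⟨cell q w ∪ ⋃ i, cutOff q (v i) (j i) (c i * cellSize q w),
    ⟨⟨w, rfl, hx, hb, v, j, c, fun i => ⟨hl i, hinter i, hp i, hc i⟩, rfl⟩, fun f hf => ?_⟩,
    hq.cutOffUnion_mem_nhdsWithin hl hne hp hx hpos, Or.inl hx, ?_⟩
  · rw [hq.setAverage_cutOffUnion hl hne hinj hp hb hac hf, hval f hf]
  · have hcell : ∀ (u : List (Fin 3)) (y z : Plane), u.length = w.length → y ∈ cell q u →
        z ∈ cell q u → dist y z ≤ (1 / 2 : ℝ) ^ w.length * R := by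
      rintro u _ _ hu ⟨y, hy, rfl⟩ ⟨z, hz, rfl⟩
      rw [dist_Fw, hu]
      exact mul_le_mul_of_nonneg_left (hR y hy z hz) (by positivity)
    rintro y (hy | hy)
    · have h := hcell w y x rfl hy hx
      have := dist_nonneg (x := y) (y := x)
      linarith
    · obtain ⟨i, hyi⟩ := Set.mem_iUnion.1 hy
      have h1 := hcell (v i) y (Fw q w (q i)) (hl i) hyi.1 ⟨q (j i), corner_mem_gasket q _, hp i⟩
      have h2 := hcell w (Fw q w (q i)) x rfl ⟨q i, corner_mem_gasket q i, rfl⟩ hx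
      linarith [dist_triangle y (Fw q w (q i)) x]

end IsEquilateral

/-! ### Assembling the base of neighborhoods -/

lemma IsMeanValueNhd.subset_gasket {k : ℕ} {x : Plane} {B : Set Plane}
    (hB : IsMeanValueNhd q k x B) : B ⊆ gasket q := by
  obtain ⟨⟨w, -, -, -, v, j, c, -, rfl⟩, -⟩ := hB
  exact Set.union_subset (cell_subset_gasket q w)
    (Set.iUnion_subset fun i _ hy => cell_subset_gasket q (v i) hy.1)

lemma tendsto_half_pow_mul (R : ℝ) :
    Filter.Tendsto (fun k : ℕ => (1 / 2 : ℝ) ^ k * R) Filter.atTop (𝓝 0) := by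
  simpa using (tendsto_pow_atTop_nhds_zero_of_lt_one (by norm_num : (0 : ℝ) ≤ 1 / 2)
    (by norm_num)).mul_const R

/-- A point of the gasket that is not a corner lies in a cell without corners of the gasket. -/
lemma exists_cell_disjoint_boundary {x : Plane} (hx : x ∈ gasket q \ boundary q) :
    ∃ k, ∃ w : List (Fin 3), w.length = k ∧ x ∈ cell q w ∧ Disjoint (cell q w) (boundary q) := by
  obtain ⟨R, -, hR⟩ := exists_dist_le q
  have hcl : IsClosed (boundary q) := (Set.finite_range q).isClosed
  obtain ⟨ε, hε, hball⟩ := Metric.isOpen_iff.1 hcl.isOpen_compl x hx.2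
  obtain ⟨k, hk⟩ := ((tendsto_half_pow_mul R).eventually_lt_const hε).exists
  obtain ⟨w, hw, hxw⟩ := exists_mem_cell hx.1 k
  refine ⟨k, w, hw, hxw, Set.disjoint_left.2 fun y hy => hball ?_⟩
  obtain ⟨z, hz, rfl⟩ := hxw
  obtain ⟨t, ht, rfl⟩ := hy
  rw [Metric.mem_ball, dist_Fw, hw]
  exact (mul_le_mul_of_nonneg_left (hR t ht z hz) (by positivity)).trans_lt hk

lemma exists_longer_cell {x : Plane} {k₀ k : ℕ} (hk : k₀ ≤ k)
    (h : ∃ w : List (Fin 3), w.length = k₀ ∧ x ∈ cell q w ∧ Disjoint (cell q w) (boundary q)) :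
    ∃ w : List (Fin 3), w.length = k ∧ x ∈ cell q w ∧ Disjoint (cell q w) (boundary q) := by
  induction k, hk using Nat.le_induction with
  | base => exact h
  | succ k _ ih =>
    obtain ⟨w, hw, hxw, hb⟩ := ih
    obtain ⟨i, hi⟩ := exists_mem_cell_snoc hxw
    exact ⟨w ++ [i], by simp [hw], hi, hb.mono_left (cell_snoc_subset q w i)⟩

end SierpinskiGasket

end

open SierpinskiGasket
theorem theorem3p2 (q : Fin 3 → Plane) (s : ℝ) (hs : 0 < s)
    (hq : ∀ i j, i ≠ j → dist (q i) (q j) = s)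
    (x : Plane) (hx : x ∈ gasket q \ boundary q) :
    ∃ (k₀ : ℕ) (B : ℕ → Set Plane),
      IsLeast {k | ∃ w : List (Fin 3), w.length = k ∧ x ∈ cell q w ∧
        Disjoint (cell q w) (boundary q)} k₀ ∧
      (∀ k, k₀ ≤ k → IsMeanValueNhd q k x (B k)) ∧
      (𝓝[gasket q] x).HasBasis (fun k => k₀ ≤ k) B ∧
      (⋂ k ≥ k₀, B k) = {x} := by
  classical
  have hE : IsEquilateral q s := ⟨hs, hq⟩
  obtain ⟨R, -, hR⟩ := exists_dist_le q
  have hex := exists_cell_disjoint_boundary hx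
  have hB : ∀ k, ∃ B : Set Plane, Nat.find hex ≤ k → IsMeanValueNhd q k x B ∧
      B ∈ 𝓝[gasket q] x ∧ x ∈ B ∧ ∀ y ∈ B, dist y x ≤ (1 / 2 : ℝ) ^ k * (2 * R) := by
    intro k
    by_cases hk : Nat.find hex ≤ k
    · obtain ⟨w, rfl, hxw, hb⟩ := exists_longer_cell hk (Nat.find_spec hex)
      obtain ⟨B, hB⟩ := hE.exists_meanValueNhd hxw hb hR
      exact ⟨B, fun _ => hB⟩
    -- Below the least admissible level the set is arbitrary.
    · exact ⟨∅, fun h => absurd h hk⟩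
  choose B hB using hB
  have hsmall : ∀ ε > 0, ∃ k, Nat.find hex ≤ k ∧ ∀ y ∈ B k, dist y x < ε := by
    intro ε hε
    obtain ⟨k, hk, hkε⟩ := ((Filter.eventually_ge_atTop (Nat.find hex)).and
      ((tendsto_half_pow_mul (2 * R)).eventually_lt_const hε)).exists
    exact ⟨k, hk, fun y hy => ((hB k hk).2.2.2 y hy).trans_lt hkε⟩
  refine ⟨Nat.find hex, B, ⟨Nat.find_spec hex, fun k hk => Nat.find_min' hex hk⟩,
    fun k hk => (hB k hk).1, ⟨fun t => ⟨fun ht => ?_, ?_⟩⟩, ?_⟩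
  · obtain ⟨ε, hε, hεt⟩ := Metric.mem_nhdsWithin_iff.1 ht
    obtain ⟨k, hk, h⟩ := hsmall ε hε
    exact ⟨k, hk, fun y hy => hεt ⟨h y hy, (hB k hk).1.subset_gasket hy⟩⟩
  · rintro ⟨k, hk, hkt⟩
    exact Filter.mem_of_superset (hB k hk).2.1 hkt
  · refine Set.Subset.antisymm (fun y hy => ?_) ?_
    · rw [Set.mem_singleton_iff]
      by_contra hne
      obtain ⟨k, hk, h⟩ := hsmall _ (dist_pos.2 hne)
      exact lt_irrefl _ (h y (Set.mem_iInter₂.1 hy k hk))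
    · rintro _ rfl
      exact Set.mem_iInter₂.2 fun k hk => (hB k hk).2.2.1
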